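/- Let $d\in(0,1/2)$ and $a_0,a_1\in\mathbb{R}$. Let $\{\varepsilon_n\}_{n\in\mathbb{Z}}$ be an $\mathbb{R}^2$-valued white noise series (square integrable, $\mathbb{E}\varepsilon_n=0$, $\mathbb{E}\varepsilon_n\varepsilon_n^T=I_2$, $\mathbb{E}\varepsilon_n\varepsilon_m^T=0$ for $n\ne m$), and let $Y$ be the bivariate series $$Y_n=\sum_{l=-\infty}^{\infty}A_l\,\varepsilon_{n-l},\qquad n\in\mathbb{Z}$$ (convergence in mean square), where each $A_l\in\mathbb{R}^{2\times2}$ is of the form $A_l=\begin{pmatrix}a_{0,l}&a_{1,l}\\-a_{1,l}&a_{0,l}\end{pmatrix}$ and $$A_l\sim A^+\,l^{d-1}\ (l\to+\infty),\qquad A_l\sim A^-\,(-l)^{d-1}\ (l\to-\infty),\qquad A^+=\begin{pmatrix}a_0&a_1\\-a_1&a_0\end{pmatrix}=(A^-)^T.$$ Here and below $\sim$ between matrices is meant entrywise, a zero limiting constant meaning that the entry is of smaller order. Let $\gamma_Y(h)=\mathbb{E}Y_hY_0^T$, $h\in\mathbb{Z}$. Then there are $r_0,r_1\in\mathbb{R}$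 such that $$\gamma_Y(h)\sim\begin{pmatrix}r_0&-r_1\\r_1&r_0\end{pmatrix}h^{2d-1}\qquad(h\to+\infty),$$ and any such $r_0,r_1$ are given by $$r_0=\frac{\Gamma^2(d)}{\Gamma(2d)}\left[(a_0^2+a_1^2)\frac{1}{\cos(\pi d)}+(a_0^2-a_1^2)\right],\qquad r_1=-2a_0a_1\frac{\Gamma^2(d)}{\Gamma(2d)}.$$ Further, if $f_Y$ is a spectral density of $Y$, that is, an integrable function from $(-\pi,\pi)$ to $\mathbb{C}^{2\times2}$ with $\gamma_Y(h)=\int_{-\pi}^{\pi}e^{ih\lambda}f_Y(\lambda)\,d\lambda$ for all $h\in\mathbb{Z}$, and if for some $g_0,g_1\in\mathbb{R}$ $$f_Y(\lambda)\sim\begin{pmatrix}g_0&ig_1\\-ig_1&g_0\end{pmatrix}\lambda^{-2d}\qquad(\lambda\to0^+),$$ then $$g_0=\frac{\Gamma(2d)}{\pi}\cos(\pi d)\,r_0,\qquad g_1=\frac{\Gamma(2d)}{\pi}\sin(\pi d)\,r_1.$$ -/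

import Mathlib

open MeasureTheory Filter Topology

namespace BivariateLM

/-- `ε` is a bivariate white noise series: square integrable, `E ε_n = 0`,
`E ε_n ε_nᵀ = I₂`, and `E ε_n ε_mᵀ = 0` for `n ≠ m`. -/
structure IsWhiteNoise {Ω : Type*} [MeasurableSpace Ω] (P : Measure Ω)
    (ε : ℤ → Ω → Fin 2 → ℝ) : Prop where
  memLp : ∀ n i, MemLp (fun ω => ε n ω i) 2 P
  mean_zero : ∀ n i, ∫ ω, ε n ω i ∂P = 0
  cov_self : ∀ n i j, ∫ ω, ε n ω i * ε n ω j ∂P = (1 : Matrix (Fin 2) (Fin 2) ℝ) i j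
  cov_ne : ∀ n m, n ≠ m → ∀ i j, ∫ ω, ε n ω i * ε m ω j ∂P = 0

/-- `Y_n = ∑_{l ∈ ℤ} A_l ε_{n-l}` for every `n`, the two-sided series being (unconditionally)
convergent in mean square, coordinate by coordinate. -/
structure IsLinearProcess {Ω : Type*} [MeasurableSpace Ω] (P : Measure Ω)
    (ε : ℤ → Ω → Fin 2 → ℝ) (A : ℤ → Matrix (Fin 2) (Fin 2) ℝ)
    (Y : ℤ → Ω → Fin 2 → ℝ) : Prop where
  memLp : ∀ n i, MemLp (fun ω => Y n ω i) 2 P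
  tendsto : ∀ n i, Tendsto
    (fun s : Finset ℤ =>
      eLpNorm (fun ω => Y n ω i - ∑ l ∈ s, (A l).mulVec (ε (n - l) ω) i) 2 P)
    atTop (𝓝 0)

/-- The matrix autocovariance function `γ_Y(h) = E Y_h Y_0ᵀ` of a centred stationary series. -/
noncomputable def acvf {Ω : Type*} [MeasurableSpace Ω] (P : Measure Ω)
    (Y : ℤ → Ω → Fin 2 → ℝ) (h : ℤ) : Matrix (Fin 2) (Fin 2) ℝ :=
  Matrix.of fun i j => ∫ ω, Y h ω i * Y 0 ω j ∂P

/-- The rotation-type matrix `(x, y; -y, x)`. -/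
def rotMat (x y : ℝ) : Matrix (Fin 2) (Fin 2) ℝ :=
  !![x, y; -y, x]

/-- `F n ∼ C n^p` as `n → +∞`, entry by entry; for an entry `C i j = 0` this means
`F n i j = o(n^p)`. -/
def MatAsymp (F : ℕ → Matrix (Fin 2) (Fin 2) ℝ) (C : Matrix (Fin 2) (Fin 2) ℝ) (p : ℝ) : Prop :=
  ∀ i j, Tendsto (fun n : ℕ => F n i j / (n : ℝ) ^ p) atTop (𝓝 (C i j))

/-- `f` is (a version of) the spectral density on `(-π, π)` of a series with matrix
autocovariance function `γ`: it is integrable and `γ(h) = ∫_{-π}^{π} e^{ihx} f(x) dx` for all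
integers `h`. This determines `f` up to a null set. -/
structure IsSpectralDensity (γ : ℤ → Matrix (Fin 2) (Fin 2) ℝ)
    (f : ℝ → Matrix (Fin 2) (Fin 2) ℂ) : Prop where
  integrable : ∀ i j, IntervalIntegrable (fun x => f x i j) volume (-Real.pi) Real.pi
  fourier : ∀ (h : ℤ) i j, ((γ h i j : ℝ) : ℂ) =
    ∫ x in (-Real.pi)..Real.pi, Complex.exp (Complex.I * (h : ℂ) * (x : ℂ)) * f x i j

/-- `f x ∼ G x^p` as `x → 0⁺`, entry by entry (with `o(x^p)` for a zero entry of `G`). -/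
def MatAsympZero (f : ℝ → Matrix (Fin 2) (Fin 2) ℂ) (G : Matrix (Fin 2) (Fin 2) ℂ)
    (p : ℝ) : Prop :=
  ∀ i j, Tendsto (fun x : ℝ => f x i j / ((x ^ p : ℝ) : ℂ)) (𝓝[>] 0) (𝓝 (G i j))

end BivariateLM

/-!
The autocovariance of the linear process is `γ(h) = ∑ m, A_{m+h} A_mᵀ`
(`IsLinearProcess.hasSum_acvf`): in `L²` the process is an unconditional sum of noise terms, which
are orthonormal, and sums pass through inner products.

Each entry of `γ(h)` is therefore a finite sum of cross-correlations `∑ m, u (m + h) v m` of scalar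
sequences with power-law tails of exponent `d - 1`. Written as the integral of a step function and
rescaled by `h`, such a sum is `h ^ (2 d - 1)` times an integral over `t ∈ ℝ` whose integrand tends
to a multiple of `|t + 1| ^ (d - 1) |t| ^ (d - 1)` and is dominated by a fixed multiple of it
(`tendsto_crossCorrelation`). The half-lines `t > 0` and `t < -1` contribute `B(d, 1 - 2 d)` each
and the interval `(-1, 0)` contributes `B(d, d)`; the ratio of the two is `1 / (2 cos (π d))` by the
reflection formula. Only the middle interval mixes the limits at `+∞` and at `-∞`.

For the spectral constants, the Abel sums `∑_{n ≥ 0} e^{-n / x} γ(n)` are computed twice as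
`x → ∞`. From `γ(n) ∼ r n ^ (2 d - 1)` they are `∼ r Γ(2 d) x ^ (2 d)` (`tendsto_abel_sum`). They
also equal the integral of the spectral density against `1 / (1 - e^{-1 / x + i y})`. By uniqueness
of Fourier coefficients the diagonal entries of the density are even and the off-diagonal ones odd,
so the integral folds onto `(0, π)`, where `f ∼ g y ^ (-2 d)` at `0⁺` determines it to leading order
(`tendsto_integral_foldedKernel`), with no regularity of `f` needed away from `0`. Comparing the two
gives `g` in terms of `r` and the Mellin transform of `1 / (1 + t ^ 2)`.
-/

open MeasureTheory Filter Topology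
namespace BivariateLM

/-! ### Beta integrals on the half-line -/

theorem image_div_one_sub_Ioo :
    (fun x : ℝ => x / (1 - x)) '' Set.Ioo 0 1 = Set.Ioi 0 := by
  ext y
  constructor
  · rintro ⟨x, ⟨h0, h1⟩, rfl⟩
    exact div_pos h0 (by linarith)
  · intro hy
    have hy : 0 < y := hy
    refine ⟨y / (1 + y), ⟨by positivity, ?_⟩, ?_⟩
    · rw [div_lt_one (by positivity)]; linarith
    · have : 1 + y ≠ 0 := by positivity
      field_simp
      ring

theorem injOn_div_one_sub_Ioo : Set.InjOn (fun x : ℝ => x / (1 - x)) (Set.Ioo 0 1) := by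
  rintro x ⟨_, hx⟩ y ⟨_, hy⟩ h
  have h1 : 1 - x ≠ 0 := by linarith
  have h2 : 1 - y ≠ 0 := by linarith
  simp only at h
  field_simp at h
  linarith

theorem hasDerivWithinAt_div_one_sub {x : ℝ} (hx : x ∈ Set.Ioo (0 : ℝ) 1) :
    HasDerivWithinAt (fun x : ℝ => x / (1 - x)) ((1 - x) ^ (-2 : ℝ)) (Set.Ioo 0 1) x := by
  have h1 : 0 < 1 - x := by linarith [hx.2]
  have := ((hasDerivAt_id x).div ((hasDerivAt_id x).const_sub 1) h1.ne').hasDerivWithinAt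
    (s := Set.Ioo 0 1)
  refine this.congr_deriv ?_
  rw [Real.rpow_neg h1.le, Real.rpow_two]
  simp only [id]
  field_simp
  ring

theorem betaKernel_comp_div_one_sub (p q : ℝ) {x : ℝ} (hx : x ∈ Set.Ioo (0 : ℝ) 1) :
    |(1 - x) ^ (-2 : ℝ)| • ((x / (1 - x)) ^ (p - 1) * (1 + x / (1 - x)) ^ (-(p + q))) =
      x ^ (p - 1) * (1 - x) ^ (q - 1) := by
  have h0 := hx.1
  have h1 : 0 < 1 - x := by linarith [hx.2]
  have h2 : 1 + x / (1 - x) = (1 - x)⁻¹ := by field_simp; ring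
  rw [h2, abs_of_pos (by positivity), smul_eq_mul, Real.inv_rpow h1.le,
    Real.rpow_neg h1.le (p + q), inv_inv, Real.div_rpow h0.le h1.le, div_eq_mul_inv,
    ← Real.rpow_neg h1.le]
  have : (1 - x) ^ (q - 1) = (1 - x) ^ (-2 : ℝ) * (1 - x) ^ (-(p - 1)) * (1 - x) ^ (p + q) := by
    rw [← Real.rpow_add h1, ← Real.rpow_add h1]; ring_nf
  rw [this]; ring

/-- The integrand of Euler's beta integral in complex form restricts to the real one. -/
theorem ofReal_beta_integrand (p q : ℝ) {x : ℝ} (h0 : 0 ≤ x) (h1 : x ≤ 1) :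
    (x : ℂ) ^ ((p : ℂ) - 1) * (1 - (x : ℂ)) ^ ((q : ℂ) - 1) =
      ((x ^ (p - 1) * (1 - x) ^ (q - 1) : ℝ) : ℂ) := by
  rw [Complex.ofReal_mul, Complex.ofReal_cpow h0, Complex.ofReal_cpow (by linarith)]
  push_cast; rfl

theorem integrableOn_beta {p q : ℝ} (hp : 0 < p) (hq : 0 < q) :
    IntegrableOn (fun x : ℝ => x ^ (p - 1) * (1 - x) ^ (q - 1)) (Set.Ioo 0 1) := by
  have h := Complex.betaIntegral_convergent (u := p) (v := q) (by simpa) (by simpa)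
  rw [intervalIntegrable_iff_integrableOn_Ioo_of_le zero_le_one] at h
  refine (Integrable.re h).congr ?_
  filter_upwards [ae_restrict_mem measurableSet_Ioo] with x hx
  rw [ofReal_beta_integrand p q hx.1.le hx.2.le]
  simp

theorem integral_beta {p q : ℝ} (hp : 0 < p) (hq : 0 < q) :
    ∫ x in Set.Ioo (0 : ℝ) 1, x ^ (p - 1) * (1 - x) ^ (q - 1) =
      Real.Gamma p * Real.Gamma q / Real.Gamma (p + q) := by
  have h := Complex.betaIntegral_eq_Gamma_mul_div p q (by simpa) (by simpa)
  rw [Complex.betaIntegral, intervalIntegral.integral_of_le zero_le_one,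
    integral_Ioc_eq_integral_Ioo] at h
  apply Complex.ofReal_injective
  rw [← integral_complex_ofReal]
  push_cast
  rw [← Complex.Gamma_ofReal, ← Complex.Gamma_ofReal, ← Complex.Gamma_ofReal, Complex.ofReal_add,
    ← h]
  refine setIntegral_congr_fun measurableSet_Ioo fun x hx => ?_
  rw [ofReal_beta_integrand p q hx.1.le hx.2.le]
  push_cast; rfl

theorem integrableOn_beta_Ioi {p q : ℝ} (hp : 0 < p) (hq : 0 < q) :
    IntegrableOn (fun t : ℝ => t ^ (p - 1) * (1 + t) ^ (-(p + q))) (Set.Ioi 0) := by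
  rw [← image_div_one_sub_Ioo, integrableOn_image_iff_integrableOn_abs_deriv_smul measurableSet_Ioo
    (fun x hx => hasDerivWithinAt_div_one_sub hx) injOn_div_one_sub_Ioo]
  exact (integrableOn_beta hp hq).congr_fun
    (fun x hx => (betaKernel_comp_div_one_sub p q hx).symm) measurableSet_Ioo

/-- The beta integral in its half-line form, by the substitution `t = x / (1 - x)`. -/
theorem integral_beta_Ioi {p q : ℝ} (hp : 0 < p) (hq : 0 < q) :
    ∫ t in Set.Ioi (0 : ℝ), t ^ (p - 1) * (1 + t) ^ (-(p + q)) =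
      Real.Gamma p * Real.Gamma q / Real.Gamma (p + q) := by
  rw [← integral_beta hp hq, ← image_div_one_sub_Ioo,
    integral_image_eq_integral_abs_deriv_smul measurableSet_Ioo
    (fun x hx => hasDerivWithinAt_div_one_sub hx) injOn_div_one_sub_Ioo]
  exact setIntegral_congr_fun measurableSet_Ioo
    (fun x hx => betaKernel_comp_div_one_sub p q hx)

/-- The Mellin transform of `1 / (1 + t ^ 2)`. -/
theorem integral_rpow_div_one_add_sq {a : ℝ} (ha0 : 0 < a) (ha2 : a < 2) :
    ∫ t in Set.Ioi (0 : ℝ), t ^ (a - 1) / (1 + t ^ 2) =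
      Real.pi / (2 * Real.sin (Real.pi * (a / 2))) := by
  have h := integral_beta_Ioi (p := a / 2) (q := 1 - a / 2) (by linarith) (by linarith)
  rw [← integral_comp_rpow_Ioi_of_pos (p := 2) two_pos, Real.Gamma_mul_Gamma_one_sub,
    add_sub_cancel, Real.Gamma_one, div_one] at h
  rw [show Real.pi / (2 * Real.sin (Real.pi * (a / 2))) =
    (1 / 2) * (Real.pi / Real.sin (Real.pi * (a / 2))) by ring, ← h, ← integral_const_mul]
  refine setIntegral_congr_fun measurableSet_Ioi fun t ht => ?_
  have ht : 0 < t := ht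
  simp only [smul_eq_mul]
  rw [Real.rpow_neg_one, ← Real.rpow_mul ht.le, Real.rpow_two]
  have : t ^ (a - 1) = t ^ ((2 : ℝ) - 1) * t ^ (2 * (a / 2 - 1)) := by
    rw [← Real.rpow_add ht]; ring_nf
  rw [this]
  ring

/-- The ratio of the two beta values `B(d, 1 - 2d)` and `B(d, d)` is `1 / (2 cos (π d))`, by the
reflection formula at `d` and at `2 d`. -/
theorem beta_one_sub_two_mul {d : ℝ} (hd0 : 0 < d) (hd1 : d < 1 / 2) :
    Real.Gamma d * Real.Gamma (1 - 2 * d) / Real.Gamma (1 - d) =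
      Real.Gamma d ^ 2 / Real.Gamma (2 * d) * (1 / (2 * Real.cos (Real.pi * d))) := by
  have e1 := Real.Gamma_mul_Gamma_one_sub d
  have e2 := Real.Gamma_mul_Gamma_one_sub (2 * d)
  have g1 := Real.Gamma_pos_of_pos hd0
  have g2 := Real.Gamma_pos_of_pos (show 0 < 2 * d by linarith)
  have g3 := Real.Gamma_pos_of_pos (show 0 < 1 - d by linarith)
  have hs : 0 < Real.sin (Real.pi * d) :=
    Real.sin_pos_of_pos_of_lt_pi (by positivity) (by nlinarith [Real.pi_pos])
  have hc : 0 < Real.cos (Real.pi * d) :=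
    Real.cos_pos_of_mem_Ioo ⟨by nlinarith [Real.pi_pos], by nlinarith [Real.pi_pos]⟩
  rw [show Real.pi * (2 * d) = 2 * (Real.pi * d) by ring, Real.sin_two_mul] at e2
  have e1' : Real.Gamma (1 - d) = Real.pi / (Real.sin (Real.pi * d) * Real.Gamma d) := by
    rw [eq_div_iff (by positivity)]
    calc _ = Real.Gamma d * Real.Gamma (1 - d) * Real.sin (Real.pi * d) := by ring
      _ = _ := by rw [e1]; field_simp
  have e2' : Real.Gamma (1 - 2 * d) = Real.pi /
      (2 * Real.sin (Real.pi * d) * Real.cos (Real.pi * d) * Real.Gamma (2 * d)) := by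
    rw [eq_div_iff (by positivity)]
    calc _ = Real.Gamma (2 * d) * Real.Gamma (1 - 2 * d) *
          (2 * Real.sin (Real.pi * d) * Real.cos (Real.pi * d)) := by ring
      _ = _ := by rw [e2]; field_simp
  rw [e1', e2']
  have := Real.pi_pos
  field_simp

/-! ### Sums of power-law sequences as integrals of step functions -/

/-- A two-sided series is the integral over `ℝ` of its step function. -/
theorem hasSum_integral_floor {g : ℤ → ℝ} (hg : Integrable (fun x : ℝ => g ⌊x⌋)) :
    HasSum g (∫ x : ℝ, g ⌊x⌋) := by
  have h := hasSum_integral_iUnion (μ := volume) (f := fun x : ℝ => g ⌊x⌋)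
    (s := fun n : ℤ => Set.Ico (n : ℝ) (n + 1)) (fun _ => measurableSet_Ico)
    (Set.pairwise_disjoint_Ico_intCast ℝ) hg.integrableOn
  rw [iUnion_Ico_intCast, setIntegral_univ] at h
  convert! h using 1
  ext n
  have : ∫ x in Set.Ico (n : ℝ) (n + 1), g ⌊x⌋ = ∫ x in Set.Ico (n : ℝ) (n + 1), g n := by
    refine setIntegral_congr_fun measurableSet_Ico fun x hx => ?_
    rw [Int.floor_eq_iff.2 hx]
  rw [this]
  simp

/-- The function equal to `a t ^ p` for `t > 0` and to `b |t| ^ p` for `t ≤ 0`. -/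
noncomputable def twoSidedPow (a b p t : ℝ) : ℝ := (if 0 < t then a else b) * |t| ^ p

/-- A two-sided sequence with `u l ∼ a l ^ p` at `+∞` and `u l ∼ b |l| ^ p` at `-∞`. -/
structure TwoSidedAsymp (u : ℤ → ℝ) (a b p : ℝ) : Prop where
  pos : Tendsto (fun n : ℕ => u n / (n : ℝ) ^ p) atTop (𝓝 a)
  neg : Tendsto (fun n : ℕ => u (-n) / (n : ℝ) ^ p) atTop (𝓝 b)

/-- The shift `n + 1` makes the bound meaningful at `n = 0`, where `0 ^ p = 0` for `p < 0`. -/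
theorem exists_bound_nat {v : ℕ → ℝ} {a p : ℝ} (hp : p < 0)
    (hv : Tendsto (fun n : ℕ => v n / (n : ℝ) ^ p) atTop (𝓝 a)) :
    ∃ C, 0 ≤ C ∧ ∀ n : ℕ, |v n| ≤ C * ((n : ℝ) + 1) ^ p := by
  obtain ⟨M, hM⟩ := hv.norm.bddAbove_range
  have hM' : ∀ n : ℕ, |v n / (n : ℝ) ^ p| ≤ M := fun n => hM ⟨n, rfl⟩
  have hM0 : 0 ≤ M := (abs_nonneg _).trans (hM' 0)
  refine ⟨|v 0| + M * 2 ^ (-p), by positivity, fun n => ?_⟩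
  rcases Nat.eq_zero_or_pos n with rfl | hn
  · simp; positivity
  have hn' : (1 : ℝ) ≤ n := by exact_mod_cast hn
  have hn0 : (0 : ℝ) < n := by linarith
  have h1 : |v n| ≤ M * (n : ℝ) ^ p := by
    have := hM' n
    rwa [abs_div, abs_of_pos (Real.rpow_pos_of_pos hn0 p),
      div_le_iff₀ (Real.rpow_pos_of_pos hn0 p)] at this
  have h2 : (n : ℝ) ^ p ≤ 2 ^ (-p) * ((n : ℝ) + 1) ^ p := by
    rw [Real.rpow_neg two_pos.le, ← Real.inv_rpow two_pos.le,
      ← Real.mul_rpow (by positivity) (by positivity)]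
    exact Real.rpow_le_rpow_of_nonpos (by positivity) (by linarith) hp.le
  calc |v n| ≤ M * (2 ^ (-p) * ((n : ℝ) + 1) ^ p) := h1.trans (by gcongr)
    _ ≤ _ := by
      have : 0 ≤ |v 0| * ((n : ℝ) + 1) ^ p := by positivity
      linarith

theorem TwoSidedAsymp.exists_bound {u : ℤ → ℝ} {a b p : ℝ} (hu : TwoSidedAsymp u a b p)
    (hp : p < 0) : ∃ C, 0 ≤ C ∧ ∀ l : ℤ, |u l| ≤ C * (|(l : ℝ)| + 1) ^ p := by
  obtain ⟨C, hC, h1⟩ := exists_bound_nat hp hu.pos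
  obtain ⟨D, hD, h2⟩ := exists_bound_nat (v := fun n : ℕ => u (-n)) hp hu.neg
  refine ⟨C + D, by positivity, fun l => ?_⟩
  have key : 0 ≤ (|(l : ℝ)| + 1) ^ p := by positivity
  obtain ⟨n, rfl | rfl⟩ := l.eq_nat_or_neg
  · have := h1 n
    simp only [Int.cast_natCast, Nat.abs_cast] at key ⊢
    nlinarith [mul_nonneg hD key]
  · have := h2 n
    simp only [Int.cast_neg, Int.cast_natCast, abs_neg, Nat.abs_cast] at key ⊢
    nlinarith [mul_nonneg hC key]

theorem abs_le_abs_floor_add_one (y : ℝ) : |y| ≤ |(⌊y⌋ : ℝ)| + 1 := by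
  have h1 := Int.floor_le y
  have h2 := Int.lt_floor_add_one y
  rcases abs_cases y with h | h <;> rcases abs_cases (⌊y⌋ : ℝ) with h' | h' <;> linarith

/-- Sampling a sequence of order `|l| ^ p` at `⌊x t⌋` and rescaling by `x ^ (-p)` is dominated by
`|t| ^ p`, uniformly in `x`. -/
theorem abs_rpow_mul_floor_le {u : ℤ → ℝ} {C p : ℝ} (hp : p < 0)
    (hC : ∀ l : ℤ, |u l| ≤ C * (|(l : ℝ)| + 1) ^ p) (hC0 : 0 ≤ C) {x t : ℝ} (hx : 0 < x)
    (ht : t ≠ 0) : |x ^ (-p) * u ⌊t * x⌋| ≤ C * |t| ^ p := by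
  have ht' : 0 < |t| := abs_pos.2 ht
  have h1 : |t| * x ≤ |(⌊t * x⌋ : ℝ)| + 1 := by
    have := abs_le_abs_floor_add_one (t * x)
    rwa [abs_mul, abs_of_pos hx] at this
  have h2 : (|(⌊t * x⌋ : ℝ)| + 1) ^ p ≤ |t| ^ p * x ^ p := by
    rw [← Real.mul_rpow ht'.le hx.le]
    exact Real.rpow_le_rpow_of_nonpos (by positivity) h1 hp.le
  have hxp : 0 < x ^ p := Real.rpow_pos_of_pos hx p
  rw [abs_mul, Real.rpow_neg hx.le, abs_of_pos (by positivity), inv_mul_le_iff₀ hxp]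
  calc |u ⌊t * x⌋| ≤ C * (|t| ^ p * x ^ p) := (hC _).trans (by gcongr)
    _ = _ := by ring

theorem tendsto_rpow_mul_of_tendsto {v : ℕ → ℝ} {a p t : ℝ}
    (hv : Tendsto (fun n : ℕ => v n / (n : ℝ) ^ p) atTop (𝓝 a)) (ht : 0 < t) {k : ℝ → ℕ}
    (hk : Tendsto (fun x => (k x : ℝ) / x) atTop (𝓝 t)) :
    Tendsto (fun x : ℝ => x ^ (-p) * v (k x)) atTop (𝓝 (a * t ^ p)) := by
  have hk' : Tendsto k atTop atTop := by
    have h : Tendsto (fun x : ℝ => (k x : ℝ) / x * x) atTop atTop :=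
      hk.pos_mul_atTop ht tendsto_id
    refine tendsto_natCast_atTop_iff.1 (h.congr' ?_)
    filter_upwards [eventually_gt_atTop 0] with x hx
    field_simp
  refine ((hv.comp hk').mul (hk.rpow_const (Or.inl ht.ne'))).congr' ?_
  filter_upwards [eventually_gt_atTop 0, hk'.eventually_gt_atTop 0] with x hx hkx
  have h0 : (0 : ℝ) < k x := by exact_mod_cast hkx
  have h1 := Real.rpow_pos_of_pos h0 p
  have h2 := Real.rpow_pos_of_pos hx p
  simp only [Function.comp]
  rw [Real.div_rpow h0.le hx.le, Real.rpow_neg hx.le]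
  field_simp

theorem TwoSidedAsymp.tendsto_floor {u : ℤ → ℝ} {a b p : ℝ} (hu : TwoSidedAsymp u a b p)
    {t : ℝ} (ht : t ≠ 0) :
    Tendsto (fun x : ℝ => x ^ (-p) * u ⌊t * x⌋) atTop (𝓝 (twoSidedPow a b p t)) := by
  rcases ht.lt_or_gt with h | h
  · rw [twoSidedPow, if_neg h.not_gt, abs_of_neg h]
    refine (tendsto_rpow_mul_of_tendsto (v := fun n : ℕ => u (-n)) hu.neg (neg_pos.2 h)
      (tendsto_nat_ceil_mul_div_atTop (neg_pos.2 h).le)).congr' ?_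
    filter_upwards [eventually_gt_atTop 0] with x hx
    rw [Int.natCast_ceil_eq_ceil (by nlinarith), neg_mul, Int.ceil_neg, neg_neg]
  · rw [twoSidedPow, if_pos h, abs_of_pos h]
    refine (tendsto_rpow_mul_of_tendsto (v := fun n : ℕ => u n) hu.pos h
      (tendsto_nat_floor_mul_div_atTop h.le)).congr' ?_
    filter_upwards [eventually_gt_atTop 0] with x hx
    rw [Int.natCast_floor_eq_floor (by positivity)]

theorem measurable_comp_floor (u : ℤ → ℝ) {f : ℝ → ℝ} (hf : Measurable f) :
    Measurable (fun t => u ⌊f t⌋) :=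
  (measurable_of_countable u).comp (Int.measurable_floor.comp hf)

/-- The half-line part `t > 0` and the middle part `-1 < t < 0` of the kernel
`|t + 1| ^ (d - 1) |t| ^ (d - 1)`; the part `t < -1` is a reflection of the former. -/
theorem twoSidedPow_mul_eq (a b a' b' d : ℝ) {t : ℝ} (h0 : t ≠ 0) (h1 : t ≠ -1) :
    twoSidedPow a b (d - 1) (t + 1) * twoSidedPow a' b' (d - 1) t =
      a * a' * (Set.Ioi 0).indicator (fun t => t ^ (d - 1) * (1 + t) ^ (-(d + (1 - 2 * d)))) t +
      b * b' * (Set.Ioi 0).indicator (fun t => t ^ (d - 1) * (1 + t) ^ (-(d + (1 - 2 * d))))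
        (-1 - t) +
      a * b' * (Set.Ioo 0 1).indicator (fun t => t ^ (d - 1) * (1 - t) ^ (d - 1)) (-t) := by
  have e : -(d + (1 - 2 * d)) = d - 1 := by ring
  rw [e]
  unfold twoSidedPow
  rcases lt_or_gt_of_ne h0 with h | h
  · rcases lt_or_gt_of_ne h1 with h' | h'
    · rw [Set.indicator_of_notMem (by simp; linarith), Set.indicator_of_mem (by simp; linarith),
        Set.indicator_of_notMem (by simp; intros; linarith), if_neg (by linarith),
        if_neg (by linarith), abs_of_neg (by linarith : t + 1 < 0), abs_of_neg h]
      ring_nf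
    · rw [Set.indicator_of_notMem (by simp; linarith),
        Set.indicator_of_notMem (by simp; linarith),
        Set.indicator_of_mem (by simp; constructor <;> linarith), if_pos (by linarith),
        if_neg (by linarith), abs_of_pos (by linarith : 0 < t + 1), abs_of_neg h]
      ring_nf
  · rw [Set.indicator_of_mem (by simpa), Set.indicator_of_notMem (by simp; linarith),
      Set.indicator_of_notMem (by simp; intros; linarith), if_pos (by linarith), if_pos h,
      abs_of_pos (by linarith : 0 < t + 1), abs_of_pos h]
    ring_nf

theorem twoSidedPow_mul_ae_eq (a b a' b' d : ℝ) :
    (fun t => twoSidedPow a b (d - 1) (t + 1) * twoSidedPow a' b' (d - 1) t) =ᵐ[volume] fun t =>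
      a * a' * (Set.Ioi 0).indicator (fun t => t ^ (d - 1) * (1 + t) ^ (-(d + (1 - 2 * d)))) t +
      b * b' * (Set.Ioi 0).indicator (fun t => t ^ (d - 1) * (1 + t) ^ (-(d + (1 - 2 * d))))
        (-1 - t) +
      a * b' * (Set.Ioo 0 1).indicator (fun t => t ^ (d - 1) * (1 - t) ^ (d - 1)) (-t) := by
  filter_upwards [Measure.ae_ne volume (0 : ℝ), Measure.ae_ne volume (-1 : ℝ)] with t h0 h1
  exact twoSidedPow_mul_eq a b a' b' d h0 h1

theorem integrable_twoSidedPow_mul (a b a' b' : ℝ) {d : ℝ} (hd0 : 0 < d) (hd1 : d < 1 / 2) :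
    Integrable fun t => twoSidedPow a b (d - 1) (t + 1) * twoSidedPow a' b' (d - 1) t := by
  have i1 := (integrable_indicator_iff measurableSet_Ioi).2
    (integrableOn_beta_Ioi hd0 (by linarith : 0 < 1 - 2 * d))
  have i2 := (integrable_indicator_iff measurableSet_Ioo).2 (integrableOn_beta hd0 hd0)
  exact (((i1.const_mul (a * a')).add ((i1.comp_sub_left (-1)).const_mul (b * b'))).add
    (i2.comp_neg.const_mul (a * b'))).congr (twoSidedPow_mul_ae_eq a b a' b' d).symm

theorem integral_twoSidedPow_mul (a b a' b' : ℝ) {d : ℝ} (hd0 : 0 < d) (hd1 : d < 1 / 2) :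
    ∫ t, twoSidedPow a b (d - 1) (t + 1) * twoSidedPow a' b' (d - 1) t =
      Real.Gamma d ^ 2 / Real.Gamma (2 * d) *
        ((a * a' + b * b') * (1 / (2 * Real.cos (Real.pi * d))) + a * b') := by
  have i1 := (integrable_indicator_iff measurableSet_Ioi).2
    (integrableOn_beta_Ioi hd0 (by linarith : 0 < 1 - 2 * d))
  have i2 := (integrable_indicator_iff measurableSet_Ioo).2 (integrableOn_beta hd0 hd0)
  rw [integral_congr_ae (twoSidedPow_mul_ae_eq a b a' b' d), integral_add, integral_add,
    integral_const_mul, integral_const_mul, integral_const_mul,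
    integral_sub_left_eq_self (fun t => (Set.Ioi (0 : ℝ)).indicator
      (fun t => t ^ (d - 1) * (1 + t) ^ (-(d + (1 - 2 * d)))) t) volume (-1),
    integral_neg_eq_self (fun t => (Set.Ioo (0 : ℝ) 1).indicator
      (fun t => t ^ (d - 1) * (1 - t) ^ (d - 1)) t) volume,
    integral_indicator measurableSet_Ioi, integral_indicator measurableSet_Ioo,
    integral_beta hd0 hd0, integral_beta_Ioi hd0 (by linarith),
    show d + (1 - 2 * d) = 1 - d by ring, beta_one_sub_two_mul hd0 hd1, ← two_mul d]
  · ring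
  · exact i1.const_mul _
  · exact (i1.comp_sub_left (-1)).const_mul _
  · exact (i1.const_mul _).add ((i1.comp_sub_left (-1)).const_mul _)
  · exact i2.comp_neg.const_mul _

/-- Cross-correlation of two sequences with power-law tails: the sum is `h ^ (2 d - 1)` times an
integral of rescaled step functions, which converges by dominated convergence. -/
theorem tendsto_crossCorrelation {u v : ℤ → ℝ} {a b a' b' d : ℝ} (hd0 : 0 < d) (hd1 : d < 1 / 2)
    (hu : TwoSidedAsymp u a b (d - 1)) (hv : TwoSidedAsymp v a' b' (d - 1)) :
    (∀ h : ℕ, 0 < h → Summable fun m : ℤ => u (m + h) * v m) ∧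
    Tendsto (fun h : ℕ => (∑' m : ℤ, u (m + h) * v m) / (h : ℝ) ^ (2 * d - 1)) atTop
      (𝓝 (Real.Gamma d ^ 2 / Real.Gamma (2 * d) *
        ((a * a' + b * b') * (1 / (2 * Real.cos (Real.pi * d))) + a * b'))) := by
  have hp : d - 1 < 0 := by linarith
  obtain ⟨C, hC0, hC⟩ := hu.exists_bound hp
  obtain ⟨D, hD0, hD⟩ := hv.exists_bound hp
  set F : ℝ → ℝ → ℝ := fun x t =>
    (x ^ (-(d - 1)) * u ⌊(t + 1) * x⌋) * (x ^ (-(d - 1)) * v ⌊t * x⌋) with hF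
  set G : ℝ → ℝ := fun t =>
    C * D * (twoSidedPow 1 1 (d - 1) (t + 1) * twoSidedPow 1 1 (d - 1) t) with hG
  have hGi : Integrable G := (integrable_twoSidedPow_mul 1 1 1 1 hd0 hd1).const_mul _
  have hFm : ∀ x, AEStronglyMeasurable (F x) volume := fun x =>
    (((measurable_comp_floor u (by fun_prop)).const_mul _).mul
      ((measurable_comp_floor v (by fun_prop)).const_mul _)).aestronglyMeasurable
  have hFG : ∀ x, 0 < x → ∀ᵐ t, ‖F x t‖ ≤ G t := by
    intro x hx
    filter_upwards [Measure.ae_ne volume (0 : ℝ), Measure.ae_ne volume (-1 : ℝ)] with t h0 h1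
    have e1 := abs_rpow_mul_floor_le hp hC hC0 hx (t := t + 1) (by contrapose! h1; linarith)
    have e2 := abs_rpow_mul_floor_le hp hD hD0 hx h0
    rw [Real.norm_eq_abs, hF, abs_mul]
    refine (mul_le_mul e1 e2 (abs_nonneg _) (by positivity)).trans (le_of_eq ?_)
    simp only [hG, twoSidedPow, ite_self, one_mul]
    ring
  have hFi : ∀ x, 0 < x → Integrable (F x) := fun x hx => hGi.mono' (hFm x) (hFG x hx)
  rw [← integral_twoSidedPow_mul a b a' b' hd0 hd1]
  have hlim : Tendsto (fun h : ℕ => ∫ t, F h t) atTop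
      (𝓝 (∫ t, twoSidedPow a b (d - 1) (t + 1) * twoSidedPow a' b' (d - 1) t)) := by
    refine tendsto_integral_filter_of_dominated_convergence G (Eventually.of_forall fun _ => hFm _)
      ?_ hGi ?_
    · filter_upwards [eventually_gt_atTop 0] with h hh
      exact hFG h (by exact_mod_cast hh)
    · filter_upwards [Measure.ae_ne volume (0 : ℝ), Measure.ae_ne volume (-1 : ℝ)] with t h0 h1
      exact ((hu.tendsto_floor (by contrapose! h1; linarith)).mul (hv.tendsto_floor h0)).comp
        tendsto_natCast_atTop_atTop
  -- Unscaling by `x = m / h`: the three factors contribute `h ^ (2 d - 1)`.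
  have hscale : ∀ h : ℕ, 0 < h → HasSum (fun m : ℤ => u (m + h) * v m)
      ((h : ℝ) ^ (2 * d - 1) * ∫ t, F h t) := by
    intro h hh
    have hx : (0 : ℝ) < h := by exact_mod_cast hh
    set g : ℤ → ℝ := fun m => u (m + h) * v m
    set c : ℝ := (h : ℝ) ^ (-(d - 1)) * (h : ℝ) ^ (-(d - 1)) with hc
    have hc0 : c ≠ 0 := by positivity
    have hFg : F h = fun t : ℝ => c * g ⌊t * h⌋ := by
      ext t
      simp only [hF, g, hc, add_mul, one_mul]
      rw [Int.floor_add_natCast]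
      ring
    have hgi : Integrable fun x : ℝ => g ⌊x⌋ := by
      have h1 := hFi h hx
      rw [hFg, integrable_const_mul_iff (isUnit_iff_ne_zero.2 hc0)] at h1
      exact (integrable_comp_mul_right_iff (fun x => g ⌊x⌋) hx.ne').1 h1
    have e : (h : ℝ) ^ (2 * d - 1) * ∫ t, F h t = ∫ y : ℝ, g ⌊y⌋ := by
      rw [hFg, integral_const_mul, Measure.integral_comp_mul_right (fun x => g ⌊x⌋), smul_eq_mul,
        abs_of_pos (by positivity), hc, ← Real.rpow_neg_one, ← mul_assoc, ← mul_assoc,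
        ← Real.rpow_add hx, ← Real.rpow_add hx, ← Real.rpow_add hx,
        show 2 * d - 1 + (-(d - 1) + -(d - 1)) + -1 = 0 by ring, Real.rpow_zero, one_mul]
    rw [e]
    exact hasSum_integral_floor hgi
  refine ⟨fun h hh => (hscale h hh).summable, hlim.congr' ?_⟩
  filter_upwards [eventually_gt_atTop 0] with h hh
  have hx : (0 : ℝ) < h := by exact_mod_cast hh
  rw [(hscale h hh).tsum_eq, mul_div_cancel_left₀ _ (Real.rpow_pos_of_pos hx _).ne']

/-- An Abelian theorem: if `c n ∼ r n ^ p` with `-1 < p < 0`, then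
`∑ e^{-n / x} c n ∼ r Γ(p + 1) x ^ (p + 1)` as `x → ∞`. -/
theorem tendsto_abel_sum {c : ℕ → ℝ} {r p : ℝ} (hp0 : -1 < p) (hp : p < 0)
    (hc : Tendsto (fun n : ℕ => c n / (n : ℝ) ^ p) atTop (𝓝 r)) :
    Tendsto (fun x : ℝ => x ^ (-(p + 1)) * ∑' n : ℕ, Real.exp (-(n / x)) * c n) atTop
      (𝓝 (r * Real.Gamma (p + 1))) := by
  -- Extension by zero to negative indices, so that the sum is an integral over all of `ℝ`.
  set u : ℤ → ℝ := fun l => if 0 ≤ l then c l.toNat else 0 with hu_def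
  have hu : TwoSidedAsymp u r 0 p := by
    constructor
    · simpa [hu_def] using hc
    · refine tendsto_const_nhds.congr' ?_
      filter_upwards [eventually_gt_atTop 0] with n hn
      simp only [hu_def]
      rw [if_neg (by omega), zero_div]
  obtain ⟨C, hC0, hC⟩ := hu.exists_bound hp
  set F : ℝ → ℝ → ℝ := fun x t =>
    Real.exp (-(⌊t * x⌋ / x)) * (x ^ (-p) * u ⌊t * x⌋) with hF
  have hΓi : IntegrableOn (fun t : ℝ => Real.exp (-t) * t ^ p) (Set.Ioi 0) := by
    simpa using Real.GammaIntegral_convergent (s := p + 1) (by linarith)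
  set G : ℝ → ℝ := (Set.Ioi 0).indicator
    fun t => C * Real.exp 1 * (Real.exp (-t) * t ^ p) with hG
  have hGi : Integrable G := (integrable_indicator_iff measurableSet_Ioi).2 (hΓi.const_mul _)
  have hFm : ∀ x, AEStronglyMeasurable (F x) volume := fun x =>
    ((measurable_comp_floor (fun l => Real.exp (-((l : ℝ) / x))) (by fun_prop)).mul
      ((measurable_comp_floor u (by fun_prop)).const_mul _)).aestronglyMeasurable
  have hneg : ∀ x t : ℝ, 0 < x → t < 0 → F x t = 0 := by
    intro x t hx ht
    have : ⌊t * x⌋ < 0 := Int.floor_lt.2 (by push_cast; nlinarith)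
    simp only [hF, hu_def]
    rw [if_neg (by omega)]
    simp
  have hFG : ∀ x, 1 ≤ x → ∀ᵐ t, ‖F x t‖ ≤ G t := by
    intro x hx1
    have hx : 0 < x := by linarith
    filter_upwards [Measure.ae_ne volume (0 : ℝ)] with t h0
    rcases lt_or_gt_of_ne h0 with h | h
    · rw [hneg x t hx h, hG, Set.indicator_of_notMem (by simp; linarith), norm_zero]
    · rw [hG, Set.indicator_of_mem (by simpa), Real.norm_eq_abs, hF, abs_mul, Real.abs_exp]
      have e1 := abs_rpow_mul_floor_le hp hC hC0 hx h0
      have e2 : Real.exp (-(⌊t * x⌋ / x)) ≤ Real.exp 1 * Real.exp (-t) := by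
        -- The factor `e` absorbs the rounding `t - ⌊t x⌋ / x < 1 / x ≤ 1`.
        rw [← Real.exp_add, Real.exp_le_exp]
        have e3 := Int.lt_floor_add_one (t * x)
        have : t ≤ ⌊t * x⌋ / x + 1 := by
          rw [← sub_le_iff_le_add, le_div_iff₀ hx]
          nlinarith
        linarith
      refine (mul_le_mul e2 e1 (abs_nonneg _) (by positivity)).trans (le_of_eq ?_)
      rw [abs_of_pos h]
      ring
  have hlim : Tendsto (fun x : ℝ => ∫ t, F x t) atTop (𝓝 (∫ t, (Set.Ioi (0 : ℝ)).indicator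
      (fun t => r * (Real.exp (-t) * t ^ p)) t)) := by
    refine tendsto_integral_filter_of_dominated_convergence G (Eventually.of_forall fun _ => hFm _)
      ?_ hGi ?_
    · filter_upwards [eventually_ge_atTop 1] with x hx using hFG x hx
    · filter_upwards [Measure.ae_ne volume (0 : ℝ)] with t h0
      rcases lt_or_gt_of_ne h0 with h | h
      · rw [Set.indicator_of_notMem (by simp; linarith)]
        refine tendsto_const_nhds.congr' ?_
        filter_upwards [eventually_gt_atTop 0] with x hx using (hneg x t hx h).symm
      · rw [Set.indicator_of_mem (by simpa)]
        have e1 := hu.tendsto_floor h0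
        rw [twoSidedPow, if_pos h, abs_of_pos h] at e1
        have e2 : Tendsto (fun x : ℝ => (⌊t * x⌋ : ℝ) / x) atTop (𝓝 t) := by
          refine (tendsto_nat_floor_mul_div_atTop h.le).congr' ?_
          filter_upwards [eventually_gt_atTop 0] with x hx
          rw [natCast_floor_eq_intCast_floor (by positivity)]
        have e3 := ((Real.continuous_exp.tendsto _).comp e2.neg).mul e1
        rwa [mul_left_comm] at e3
  rw [integral_indicator measurableSet_Ioi, integral_const_mul] at hlim
  have hΓ := Real.Gamma_eq_integral (s := p + 1) (by linarith)
  simp only [add_sub_cancel_right] at hΓ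
  rw [← hΓ] at hlim
  refine hlim.congr' ?_
  filter_upwards [eventually_ge_atTop 1] with x hx1
  have hx : 0 < x := by linarith
  set g : ℤ → ℝ := fun m => Real.exp (-((m : ℝ) / x)) * u m with hg
  have hc0 : x ^ (-p) ≠ 0 := by positivity
  have hFg : F x = fun t => x ^ (-p) * g ⌊t * x⌋ := by
    ext t
    simp only [hF, g]
    ring
  have hgi : Integrable fun y : ℝ => g ⌊y⌋ := by
    have h1 : Integrable (F x) := hGi.mono' (hFm x) (hFG x hx1)
    rw [hFg, integrable_const_mul_iff (isUnit_iff_ne_zero.2 hc0)] at h1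
    exact (integrable_comp_mul_right_iff (fun y => g ⌊y⌋) hx.ne').1 h1
  have hsum : HasSum (fun n : ℕ => Real.exp (-(n / x)) * c n) (∫ y : ℝ, g ⌊y⌋) := by
    have h1 : Set.range ((↑) : ℕ → ℤ) ⊇ Function.support g := by
      intro m hm
      have : 0 ≤ m := by
        by_contra h
        exact hm (by simp [hg, hu_def, h])
      exact ⟨m.toNat, Int.toNat_of_nonneg this⟩
    have h2 := (Function.Injective.hasSum_iff Nat.cast_injective (f := g)
      (fun m hm => by_contra fun h => hm (h1 h))).2 (hasSum_integral_floor hgi)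
    simpa [Function.comp_def, hg, hu_def] using h2
  rw [hsum.tsum_eq, hFg, integral_const_mul,
    Measure.integral_comp_mul_right (fun y => g ⌊y⌋), smul_eq_mul, abs_of_pos (by positivity),
    ← Real.rpow_neg_one, ← mul_assoc, ← Real.rpow_add hx]
  ring_nf

/-! ### The autocovariance of a linear process -/

section Covariance
variable {Ω : Type*} [MeasurableSpace Ω] {P : Measure Ω}

theorem memLp_mulVec_noise {ε : ℤ → Ω → Fin 2 → ℝ} (hε : IsWhiteNoise P ε)
    (M : Matrix (Fin 2) (Fin 2) ℝ) (n : ℤ) (i : Fin 2) :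
    MemLp (fun ω => M.mulVec (ε n ω) i) 2 P := by
  simp only [Matrix.mulVec, dotProduct]
  exact memLp_finsetSum _ fun k _ => (hε.memLp n k).const_mul _

theorem integral_mul_eq_inner {f g : Ω → ℝ} (hf : MemLp f 2 P) (hg : MemLp g 2 P) :
    ∫ ω, f ω * g ω ∂P = inner ℝ (hf.toLp f) (hg.toLp g) := by
  rw [L2.inner_def]
  refine integral_congr_ae ?_
  filter_upwards [hf.coeFn_toLp, hg.coeFn_toLp] with ω h1 h2
  rw [h1, h2]
  simp [mul_comm]

theorem IsWhiteNoise.integral_mul {ε : ℤ → Ω → Fin 2 → ℝ} (hε : IsWhiteNoise P ε)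
    (n m : ℤ) (i j : Fin 2) :
    ∫ ω, ε n ω i * ε m ω j ∂P = if n = m then (if i = j then 1 else 0) else 0 := by
  split_ifs with h h'
  · subst h h'; simp [hε.cov_self]
  · subst h; simp [hε.cov_self, h']
  · exact hε.cov_ne n m h i j

theorem IsWhiteNoise.integral_mulVec_mul_mulVec {ε : ℤ → Ω → Fin 2 → ℝ} (hε : IsWhiteNoise P ε)
    (M N : Matrix (Fin 2) (Fin 2) ℝ) (n m : ℤ) (i j : Fin 2) :
    ∫ ω, M.mulVec (ε n ω) i * N.mulVec (ε m ω) j ∂P =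
      if n = m then (M * N.transpose) i j else 0 := by
  have e : ∀ ω, M.mulVec (ε n ω) i * N.mulVec (ε m ω) j =
      ∑ k, ∑ l, M i k * N j l * (ε n ω k * ε m ω l) := by
    intro ω
    simp only [Matrix.mulVec, dotProduct, Finset.sum_mul_sum]
    refine Finset.sum_congr rfl fun k _ => Finset.sum_congr rfl fun l _ => by ring
  have hi : ∀ k l, Integrable (fun ω => M i k * N j l * (ε n ω k * ε m ω l)) P := fun k l =>
    ((hε.memLp n k).integrable_mul (hε.memLp m l)).const_mul _
  simp_rw [e]
  rw [integral_finsetSum _ fun k _ => integrable_finsetSum _ fun l _ => hi k l]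
  simp_rw [integral_finsetSum _ fun l _ => hi _ l, integral_const_mul, hε.integral_mul]
  split_ifs with h
  · simp [Matrix.mul_apply]
  · simp

/-- In `L²`, the process value at time `n` is the unconditional sum of its terms, indexed here by
the time `q` of the noise rather than by the lag `n - q`. -/
theorem IsLinearProcess.hasSum_toLp {ε Y : ℤ → Ω → Fin 2 → ℝ}
    {A : ℤ → Matrix (Fin 2) (Fin 2) ℝ} (hε : IsWhiteNoise P ε) (hY : IsLinearProcess P ε A Y)
    (n : ℤ) (i : Fin 2) :
    HasSum (fun q : ℤ => (memLp_mulVec_noise hε (A (n - q)) q i).toLp)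
      ((hY.memLp n i).toLp) := by
  have h1 : HasSum (fun l : ℤ => (memLp_mulVec_noise hε (A l) (n - l) i).toLp)
      ((hY.memLp n i).toLp) := by
    rw [HasSum, SummationFilter.unconditional_filter, tendsto_iff_norm_sub_tendsto_zero]
    have h := (ENNReal.tendsto_toReal ENNReal.zero_ne_top).comp (hY.tendsto n i)
    refine h.congr fun s => ?_
    have hs : MemLp (fun ω => ∑ l ∈ s, (A l).mulVec (ε (n - l) ω) i) 2 P :=
      memLp_finsetSum _ fun l _ => memLp_mulVec_noise hε (A l) (n - l) i
    have e : ∑ l ∈ s, (memLp_mulVec_noise hε (A l) (n - l) i).toLp = hs.toLp := by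
      refine Lp.ext ?_
      have ha : ∀ᵐ ω ∂P, ∀ l ∈ s, (memLp_mulVec_noise hε (A l) (n - l) i).toLp _ ω =
          (A l).mulVec (ε (n - l) ω) i :=
        (Finset.eventually_all s).2 fun l _ => MemLp.coeFn_toLp _
      filter_upwards [Lp.coeFn_finsetSum s
        fun l => (memLp_mulVec_noise hε (A l) (n - l) i).toLp, hs.coeFn_toLp, ha] with ω h1 h2 h3
      rw [h1, h2, Finset.sum_apply]
      exact Finset.sum_congr rfl h3
    rw [e, norm_sub_rev, ← MemLp.toLp_sub, Lp.norm_toLp]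
    rfl
  -- Reindexing by `l = n - q` is free, the convergence being unconditional.
  have h2 := (Equiv.subLeft n).hasSum_iff.2 h1
  convert! h2 using 1
  ext1 q
  simp [Function.comp]

/-- The autocovariance of a linear process: `γ(h) = ∑ m, A_{m+h} A_mᵀ`, entrywise. -/
theorem IsLinearProcess.hasSum_acvf {ε Y : ℤ → Ω → Fin 2 → ℝ}
    {A : ℤ → Matrix (Fin 2) (Fin 2) ℝ} (hε : IsWhiteNoise P ε) (hY : IsLinearProcess P ε A Y)
    (h : ℤ) (i j : Fin 2) :
    HasSum (fun m : ℤ => (A (m + h) * (A m).transpose) i j) (acvf P Y h i j) := by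
  -- By orthogonality only the noise at time `q` contributes to the inner product with `Y 0`.
  have h0 : ∀ q : ℤ, inner ℝ (memLp_mulVec_noise hε (A (h - q)) q i).toLp (hY.memLp 0 j).toLp =
      (A (h - q) * (A (-q)).transpose) i j := by
    intro q
    have := (hY.hasSum_toLp hε 0 j).mapL (innerSL ℝ (memLp_mulVec_noise hε (A (h - q)) q i).toLp)
    simp only [innerSL_apply_apply] at this
    refine this.unique ?_
    simp_rw [← integral_mul_eq_inner, hε.integral_mulVec_mul_mulVec]
    refine (hasSum_ite_eq q ((A (h - q) * (A (-q)).transpose) i j)).congr_fun ?_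
    intro q'
    by_cases hq : q' = q
    · subst hq; simp
    · simp [hq, Ne.symm hq]
  have h1 := (hY.hasSum_toLp hε h i).mapL (innerSL ℝ (hY.memLp 0 j).toLp)
  simp only [innerSL_apply_apply] at h1
  simp_rw [real_inner_comm _ ((hY.memLp 0 j).toLp), h0, ← integral_mul_eq_inner] at h1
  have h2 := (Equiv.neg ℤ).hasSum_iff.2 h1
  simp only [Function.comp_def, Equiv.neg_apply, sub_neg_eq_add, neg_neg, add_comm h] at h2
  exact h2

end Covariance

/-! ### Fourier uniqueness and the Abel kernel -/

/-- Uniqueness of Fourier coefficients for integrable functions on `(-π, π)`. -/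
theorem ae_eq_zero_of_fourier_eq_zero {F : ℝ → ℂ}
    (hF : IntervalIntegrable F volume (-Real.pi) Real.pi)
    (h0 : ∀ h : ℤ, ∫ x in (-Real.pi)..Real.pi,
      Complex.exp (Complex.I * (h : ℂ) * (x : ℂ)) * F x = 0) :
    ∀ᵐ x, x ∈ Set.Ioo (-Real.pi) Real.pi → F x = 0 := by
  have hpi := Real.pi_pos
  have : Fact (0 < 2 * Real.pi) := ⟨Real.two_pi_pos⟩
  have hint : ∀ φ : C(AddCircle (2 * Real.pi), ℂ), IntervalIntegrable
      (fun x : ℝ => φ x * F x) volume (-Real.pi) Real.pi := fun φ =>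
    hF.continuousOn_mul (φ.continuous.comp (AddCircle.continuous_mk' _)).continuousOn
  let L : C(AddCircle (2 * Real.pi), ℂ) →L[ℂ] ℂ := LinearMap.mkContinuous
    { toFun := fun φ => ∫ x in (-Real.pi)..Real.pi, φ x * F x
      map_add' := fun φ ψ => by
        simp only [ContinuousMap.add_apply, add_mul]
        exact intervalIntegral.integral_add (hint φ) (hint ψ)
      map_smul' := fun c φ => by
        simp only [ContinuousMap.smul_apply, smul_eq_mul, mul_assoc, RingHom.id_apply]
        exact intervalIntegral.integral_const_mul _ _ }
    (∫ x in (-Real.pi)..Real.pi, ‖F x‖) fun φ => by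
      simp only [LinearMap.coe_mk, AddHom.coe_mk]
      rw [← intervalIntegral.integral_mul_const]
      refine intervalIntegral.norm_integral_le_of_norm_le (by linarith)
        (Eventually.of_forall fun x _ => ?_) (hF.norm.mul_const _)
      rw [norm_mul, mul_comm]
      gcongr
      exact φ.norm_coe_le_norm _
  -- The functional vanishes on the exponentials, whose span is dense.
  have hL : ∀ φ, L φ = 0 := by
    have h1 : Submodule.span ℂ (Set.range (fourier (T := 2 * Real.pi))) ≤
        LinearMap.ker L.toLinearMap := by
      rw [Submodule.span_le]
      rintro _ ⟨n, rfl⟩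
      change ∫ x in (-Real.pi)..Real.pi, fourier n (x : AddCircle (2 * Real.pi)) * F x = 0
      rw [← h0 n]
      refine intervalIntegral.integral_congr fun x _ => ?_
      simp only [fourier_coe_apply]
      congr 2
      have : (Real.pi : ℂ) ≠ 0 := by exact_mod_cast hpi.ne'
      push_cast
      field_simp
    have h2 := Submodule.topologicalClosure_minimal _ h1 L.isClosed_ker
    rw [span_fourier_closure_eq_top] at h2
    exact fun φ => h2 Submodule.mem_top
  have hFi : IntegrableOn F (Set.Ioo (-Real.pi) Real.pi) :=
    (intervalIntegrable_iff_integrableOn_Ioo_of_le (by linarith)).1 hF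
  refine isOpen_Ioo.ae_eq_zero_of_integral_contDiff_smul_eq_zero hFi.locallyIntegrableOn ?_
  intro g hg _ hsupp
  have hg0 : ∀ y, y ∉ Set.Ioo (-Real.pi) Real.pi → g y = 0 := fun y hy =>
    image_eq_zero_of_notMem_tsupport fun h => hy (hsupp h)
  let φ : C(AddCircle (2 * Real.pi), ℂ) :=
    ⟨AddCircle.liftIco (2 * Real.pi) (-Real.pi) fun x => (g x : ℂ),
      AddCircle.liftIco_continuous (by rw [hg0 _ (by simp), hg0 _ (by simp; intros; linarith)])
        (by have := hg.continuous; fun_prop)⟩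
  have h3 : ∫ x in (-Real.pi)..Real.pi, φ x * F x = 0 := hL φ
  rw [intervalIntegral.integral_of_le (by linarith), integral_Ioc_eq_integral_Ioo] at h3
  rw [← setIntegral_eq_integral_of_forall_compl_eq_zero (s := Set.Ioo (-Real.pi) Real.pi)
    (fun x hx => by rw [hg0 x hx, zero_smul]), ← h3]
  refine setIntegral_congr_fun measurableSet_Ioo fun x hx => ?_
  have : φ (x : AddCircle (2 * Real.pi)) = g x :=
    AddCircle.liftIco_coe_apply (f := fun x => (g x : ℂ)) (a := -Real.pi)
      ⟨hx.1.le, by linarith [hx.2]⟩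
  simp only [this, Complex.real_smul]

/-- A function whose Fourier coefficients satisfy `c(-h) = σ c(h)` satisfies `f(-x) = σ f(x)`
almost everywhere. -/
theorem ae_neg_eq_mul_of_fourier {f : ℝ → ℂ} {c : ℤ → ℂ} {σ : ℂ}
    (hf : IntervalIntegrable f volume (-Real.pi) Real.pi)
    (hc : ∀ h : ℤ, c h = ∫ x in (-Real.pi)..Real.pi,
      Complex.exp (Complex.I * (h : ℂ) * (x : ℂ)) * f x)
    (hσ : ∀ h, c (-h) = σ * c h) :
    ∀ᵐ x, x ∈ Set.Ioo (-Real.pi) Real.pi → f (-x) = σ * f x := by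
  have hneg : IntervalIntegrable (fun x => f (-x)) volume (-Real.pi) Real.pi := by
    have := (IntervalIntegrable.iff_comp_neg (f := f)).1 hf
    simpa using this.symm
  -- `f (-x) - σ f x` has coefficients `c (-h) - σ c h = 0`.
  have key := ae_eq_zero_of_fourier_eq_zero (hneg.sub (hf.const_mul σ)) fun h => by
    have hcont : Continuous fun x : ℝ => Complex.exp (Complex.I * (h : ℂ) * (x : ℂ)) := by
      fun_prop
    have e1 : ∫ x in (-Real.pi)..Real.pi, Complex.exp (Complex.I * (h : ℂ) * (x : ℂ)) * f (-x) =
        c (-h) := by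
      rw [hc]
      have := intervalIntegral.integral_comp_neg (a := -Real.pi) (b := Real.pi)
        (fun x : ℝ => Complex.exp (Complex.I * ((-h : ℤ) : ℂ) * (x : ℂ)) * f x)
      rw [neg_neg] at this
      rw [← this]
      refine intervalIntegral.integral_congr fun x _ => ?_
      simp
    simp only [mul_sub]
    rw [intervalIntegral.integral_sub (hneg.continuousOn_mul hcont.continuousOn)
      ((hf.const_mul σ).continuousOn_mul hcont.continuousOn), e1, hσ, hc h,
      ← intervalIntegral.integral_const_mul, sub_eq_zero]
    refine intervalIntegral.integral_congr fun x _ => ?_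
    ring
  filter_upwards [key] with x hx hx'
  exact sub_eq_zero.1 (hx hx')

/-- The one-sided Abel kernel `∑_{n ≥ 0} e^{-s n} e^{i n y} = 1 / (1 - e^{-s + i y})`. -/
noncomputable def abelKernel (s y : ℝ) : ℂ :=
  (1 - Complex.exp (-(s : ℂ) + Complex.I * y))⁻¹

theorem norm_exp_neg_add_I_mul (s y : ℝ) :
    ‖Complex.exp (-(s : ℂ) + Complex.I * y)‖ = Real.exp (-s) := by
  rw [Complex.norm_exp]; simp

/-- Near `0` the denominator of the Abel kernel is comparable to `|s - i y|`; the constant `5` is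
a convenient choice valid for `s ≤ 1` and `|y| ≤ π`. -/
theorem add_abs_div_five_le_norm {s y : ℝ} (hs0 : 0 < s) (hs1 : s ≤ 1) (hy : |y| ≤ Real.pi) :
    (s + |y|) / 5 ≤ ‖1 - Complex.exp (-(s : ℂ) + Complex.I * y)‖ := by
  have e1 : ‖1 - Complex.exp (-(s : ℂ) + Complex.I * y)‖ ^ 2 =
      (1 - Real.exp (-s)) ^ 2 + 2 * Real.exp (-s) * (1 - Real.cos y) := by
    rw [← Complex.normSq_eq_norm_sq, Complex.normSq_apply]
    simp only [Complex.sub_re, Complex.sub_im, Complex.one_re, Complex.one_im, Complex.exp_re,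
      Complex.exp_im, Complex.add_re, Complex.add_im, Complex.neg_re, Complex.neg_im,
      Complex.ofReal_re, Complex.ofReal_im, Complex.mul_re, Complex.mul_im, Complex.I_re,
      Complex.I_im]
    ring_nf
    nlinarith [Real.sin_sq_add_cos_sq y]
  have h1 := Real.cos_le_one_sub_mul_cos_sq hy
  have h2 : (1 / 3 : ℝ) ≤ Real.exp (-s) := by
    have : Real.exp (-1) ≤ Real.exp (-s) := Real.exp_le_exp.2 (by linarith)
    have := Real.exp_neg_one_gt_d9
    linarith
  have h3 : s / 3 ≤ 1 - Real.exp (-s) := by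
    have h4 := Real.add_one_le_exp s
    have h5 : Real.exp (-s) * Real.exp s = 1 := by rw [← Real.exp_add]; simp
    nlinarith
  have h6 : y ^ 2 / 6 ≤ 1 - Real.cos y := by
    have : (1 / 6 : ℝ) ≤ 2 / Real.pi ^ 2 := by
      rw [div_le_div_iff₀ (by norm_num) (by positivity)]
      nlinarith [Real.pi_lt_d2, Real.pi_pos]
    nlinarith [sq_nonneg y]
  refine le_of_sq_le_sq ?_ (norm_nonneg _)
  rw [e1]
  have h7 : (s / 3) ^ 2 ≤ (1 - Real.exp (-s)) ^ 2 := pow_le_pow_left₀ (by positivity) h3 2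
  have h8 : (1 / 3) * (y ^ 2 / 6) ≤ Real.exp (-s) * (1 - Real.cos y) :=
    mul_le_mul h2 h6 (by positivity) (by positivity)
  nlinarith [sq_nonneg (s - |y|), sq_abs y]

theorem norm_abelKernel_le {s y : ℝ} (hs0 : 0 < s) (hs1 : s ≤ 1) (hy : |y| ≤ Real.pi) :
    ‖abelKernel s y‖ ≤ 5 / (s + |y|) := by
  have h1 := add_abs_div_five_le_norm hs0 hs1 hy
  have h2 : 0 < (s + |y|) / 5 := by positivity
  rw [abelKernel, norm_inv]
  refine (inv_anti₀ h2 h1).trans (le_of_eq ?_)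
  rw [inv_div]

theorem continuous_abelKernel {s : ℝ} (hs : 0 < s) : Continuous (abelKernel s) := by
  unfold abelKernel
  refine Continuous.inv₀ (by fun_prop) fun y h => ?_
  have := norm_exp_neg_add_I_mul s y
  rw [← sub_eq_zero.1 h, norm_one] at this
  have h' : Real.exp (-s) < 1 := Real.exp_lt_one_iff.2 (by linarith)
  linarith

/-- Abel summation of the Fourier coefficients of an integrable function. -/
theorem hasSum_exp_mul_fourier {f : ℝ → ℂ} {c : ℤ → ℂ}
    (hf : IntervalIntegrable f volume (-Real.pi) Real.pi)
    (hc : ∀ h : ℤ, c h = ∫ x in (-Real.pi)..Real.pi,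
      Complex.exp (Complex.I * (h : ℂ) * (x : ℂ)) * f x) {s : ℝ} (hs : 0 < s) :
    HasSum (fun n : ℕ => (Real.exp (-(n * s)) : ℂ) * c n)
      (∫ y in (-Real.pi)..Real.pi, abelKernel s y * f y) := by
  have hr : Real.exp (-s) < 1 := Real.exp_lt_one_iff.2 (by linarith)
  have hterm : ∀ (n : ℕ) (y : ℝ),
      (Real.exp (-(n * s)) : ℂ) * (Complex.exp (Complex.I * ((n : ℤ) : ℂ) * (y : ℂ)) * f y) =
      Complex.exp (-(s : ℂ) + Complex.I * y) ^ n * f y := by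
    intro n y
    rw [← mul_assoc, Complex.ofReal_exp, ← Complex.exp_add, ← Complex.exp_nat_mul]
    push_cast
    ring_nf
  have h := intervalIntegral.hasSum_integral_of_dominated_convergence (μ := volume)
    (a := -Real.pi) (b := Real.pi)
    (F := fun (n : ℕ) y => Complex.exp (-(s : ℂ) + Complex.I * y) ^ n * f y)
    (f := fun y => abelKernel s y * f y)
    (fun n y => Real.exp (-s) ^ n * ‖f y‖) ?_ ?_ ?_ ?_ ?_
  · convert! h using 1
    ext n
    rw [hc, ← intervalIntegral.integral_const_mul]
    exact intervalIntegral.integral_congr fun y _ => hterm n y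
  · intro n
    have : Continuous fun y : ℝ => Complex.exp (-(s : ℂ) + Complex.I * y) ^ n := by fun_prop
    exact this.aestronglyMeasurable.mul hf.def'.aestronglyMeasurable
  · intro n
    refine Eventually.of_forall fun y _ => ?_
    rw [norm_mul, norm_pow, norm_exp_neg_add_I_mul]
  · refine Eventually.of_forall fun y _ => ?_
    exact (summable_geometric_of_lt_one (Real.exp_pos _).le hr).mul_right _
  · simp_rw [tsum_mul_right]
    exact hf.norm.const_mul _
  · refine Eventually.of_forall fun y _ => ?_
    have h1 : ‖Complex.exp (-(s : ℂ) + Complex.I * y)‖ < 1 := by rwa [norm_exp_neg_add_I_mul]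
    exact HasSum.mul_right (f y) (hasSum_geometric_of_norm_lt_one h1)

/-- At the scale `y = t / x`, `s = 1 / x`, the Abel kernel becomes `1 / (1 - i t)`. -/
theorem tendsto_abelKernel_div (t : ℝ) :
    Tendsto (fun x : ℝ => (x : ℂ)⁻¹ * abelKernel x⁻¹ (t / x)) atTop
      (𝓝 (1 - Complex.I * t)⁻¹) := by
  set w : ℂ := -1 + Complex.I * t with hw
  have hw0 : -w ≠ 0 := fun h => by simpa [hw] using congrArg Complex.re h
  have hd : HasDerivAt (fun z : ℝ => Complex.exp ((z : ℂ) * w)) w 0 := by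
    have := (((hasDerivAt_id (0 : ℝ)).ofReal_comp).mul_const w).cexp
    simpa using this
  have h1 := (hasDerivAt_iff_tendsto_slope.1 hd).mono_left
    (nhdsWithin_mono (0 : ℝ) (s := Set.Ioi 0) fun z (hz : 0 < z) => hz.ne')
  have h2 := ((h1.comp tendsto_inv_atTop_nhdsGT_zero).neg).inv₀ hw0
  rw [show (1 - Complex.I * t) = -w by rw [hw]; ring]
  refine h2.congr' ?_
  filter_upwards [eventually_gt_atTop 0] with x hx
  have hx' : (x : ℂ) ≠ 0 := by exact_mod_cast hx.ne'
  simp only [Function.comp, slope_def_module, abelKernel, ← mul_inv]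
  congr 1
  rw [sub_zero, inv_inv, Complex.real_smul]
  have : ((x⁻¹ : ℝ) : ℂ) * w = -((x⁻¹ : ℝ) : ℂ) + Complex.I * ((t / x : ℝ) : ℂ) := by
    rw [hw]; push_cast; field_simp
  rw [this]
  simp only [Complex.ofReal_zero, zero_mul, Complex.exp_zero]
  ring

/-! ### Abel asymptotics of a spectral density -/

theorem integrableOn_rpow_div_one_add {d : ℝ} (hd0 : 0 < d) (hd1 : d < 1 / 2) :
    IntegrableOn (fun t : ℝ => t ^ (-2 * d) * (1 + t)⁻¹) (Set.Ioi 0) := by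
  have h := integrableOn_beta_Ioi (p := 1 - 2 * d) (q := 2 * d) (by linarith) (by linarith)
  refine h.congr_fun (fun t ht => ?_) measurableSet_Ioi
  simp only
  rw [show -(1 - 2 * d + 2 * d) = -1 by ring, Real.rpow_neg_one]
  ring_nf

/-- The Abel kernel folded onto the positive half-line with parity `σ`. -/
noncomputable def foldedKernel (σ : ℂ) (s y : ℝ) : ℂ := abelKernel s y + σ * abelKernel s (-y)

theorem norm_foldedKernel_le (σ : ℂ) {s y : ℝ} (hs0 : 0 < s) (hs1 : s ≤ 1) (hy : |y| ≤ Real.pi) :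
    ‖foldedKernel σ s y‖ ≤ (1 + ‖σ‖) * 5 / (s + |y|) := by
  have h1 := norm_abelKernel_le hs0 hs1 hy
  have h2 := norm_abelKernel_le (y := -y) hs0 hs1 (by rwa [abs_neg])
  rw [abs_neg] at h2
  calc _ ≤ ‖abelKernel s y‖ + ‖σ‖ * ‖abelKernel s (-y)‖ := by
        rw [← norm_mul]; exact norm_add_le _ _
    _ ≤ 5 / (s + |y|) + ‖σ‖ * (5 / (s + |y|)) := by gcongr
    _ = _ := by ring

theorem continuous_foldedKernel (σ : ℂ) {s : ℝ} (hs : 0 < s) : Continuous (foldedKernel σ s) :=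
  (continuous_abelKernel hs).add
    (continuous_const.mul ((continuous_abelKernel hs).comp continuous_neg))

theorem tendsto_foldedKernel_div (σ : ℂ) (t : ℝ) :
    Tendsto (fun x : ℝ => (x : ℂ)⁻¹ * foldedKernel σ x⁻¹ (t / x)) atTop
      (𝓝 ((1 - Complex.I * t)⁻¹ + σ * (1 + Complex.I * t)⁻¹)) := by
  have h1 := tendsto_abelKernel_div t
  have h2 := (tendsto_abelKernel_div (-t)).const_mul σ
  refine ((h1.add h2).congr fun x => ?_).trans (le_of_eq ?_)
  · rw [foldedKernel, neg_div]; ring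
  · congr 3
    push_cast; ring

/-- If `f y ∼ g y ^ (-2 d)` at `0⁺`, integrating `f` against the folded Abel kernel gives
`x ^ (2 d)` times an explicit constant: only the scale `y = t / x` contributes. -/
theorem tendsto_integral_foldedKernel {f : ℝ → ℂ} {g σ : ℂ} {d : ℝ} (hd0 : 0 < d)
    (hd1 : d < 1 / 2)
    (hf : IntervalIntegrable f volume 0 Real.pi)
    (hg : Tendsto (fun y : ℝ => f y / ((y ^ (-2 * d) : ℝ) : ℂ)) (𝓝[>] 0) (𝓝 g)) :
    Tendsto (fun x : ℝ => ((x ^ (-2 * d) : ℝ) : ℂ) *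
        ∫ y in (0 : ℝ)..Real.pi, foldedKernel σ x⁻¹ y * f y) atTop
      (𝓝 (∫ t in Set.Ioi (0 : ℝ), g * (((t ^ (-2 * d) : ℝ) : ℂ) *
        ((1 - Complex.I * t)⁻¹ + σ * (1 + Complex.I * t)⁻¹)))) := by
  have hpi := Real.pi_pos
  set K : ℝ := (1 + ‖σ‖) * 5 with hK
  have hK0 : 0 ≤ K := by positivity
  -- Below `δ` the function `f` is bounded by a multiple of `y ^ (-2 d)`.
  obtain ⟨δ, hδ0, hδπ, M, hM0, hM⟩ : ∃ δ, 0 < δ ∧ δ ≤ Real.pi ∧ ∃ M, 0 ≤ M ∧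
      ∀ y, 0 < y → y < δ → ‖f y‖ ≤ M * y ^ (-2 * d) := by
    have h1 : ∀ᶠ y in 𝓝[>] (0 : ℝ), ‖f y / ((y ^ (-2 * d) : ℝ) : ℂ)‖ < ‖g‖ + 1 :=
      hg.norm.eventually (gt_mem_nhds (by linarith))
    obtain ⟨δ, hδ, h2⟩ := mem_nhdsGT_iff_exists_Ioo_subset.1 h1
    have hδ : 0 < δ := hδ
    refine ⟨min δ Real.pi, lt_min hδ hpi, min_le_right _ _, ‖g‖ + 1, by positivity, ?_⟩
    intro y hy0 hy
    have h3 : ‖f y / ((y ^ (-2 * d) : ℝ) : ℂ)‖ < ‖g‖ + 1 :=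
      h2 ⟨hy0, hy.trans_le (min_le_left _ _)⟩
    have h4 : 0 < y ^ (-2 * d) := Real.rpow_pos_of_pos hy0 _
    rw [norm_div, Complex.norm_real, Real.norm_of_nonneg h4.le, div_lt_iff₀ h4] at h3
    exact h3.le
  have hf1 : IntervalIntegrable f volume 0 δ :=
    hf.mono_set (by
      rw [Set.uIcc_of_le hδ0.le, Set.uIcc_of_le hpi.le]
      exact Set.Icc_subset_Icc_right hδπ)
  have hf2 : IntervalIntegrable f volume δ Real.pi :=
    hf.mono_set (by
      rw [Set.uIcc_of_le hδπ, Set.uIcc_of_le hpi.le]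
      exact Set.Icc_subset_Icc_left hδ0.le)
  have hsplit : ∀ x : ℝ, 0 < x → ∫ y in (0 : ℝ)..Real.pi, foldedKernel σ x⁻¹ y * f y =
      (∫ y in (0 : ℝ)..δ, foldedKernel σ x⁻¹ y * f y) +
        ∫ y in δ..Real.pi, foldedKernel σ x⁻¹ y * f y := fun x hx =>
    (intervalIntegral.integral_add_adjacent_intervals
      (hf1.continuousOn_mul (continuous_foldedKernel σ (inv_pos.2 hx)).continuousOn)
      (hf2.continuousOn_mul (continuous_foldedKernel σ (inv_pos.2 hx)).continuousOn)).symm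
  -- Away from `0` the kernel is bounded, so this part is negligible.
  have hfar : Tendsto (fun x : ℝ => ((x ^ (-2 * d) : ℝ) : ℂ) *
      ∫ y in δ..Real.pi, foldedKernel σ x⁻¹ y * f y) atTop (𝓝 0) := by
    have h0 : Tendsto (fun x : ℝ => x ^ (-2 * d) * (K / δ * ∫ y in δ..Real.pi, ‖f y‖)) atTop
        (𝓝 0) := by
      have := (tendsto_rpow_neg_atTop (show 0 < 2 * d by linarith)).mul_const
        (K / δ * ∫ y in δ..Real.pi, ‖f y‖)
      simpa [neg_mul] using this
    refine squeeze_zero_norm' ?_ h0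
    filter_upwards [eventually_ge_atTop 1] with x hx1
    have hx : 0 < x := by linarith
    have h4 : 0 < x ^ (-2 * d) := Real.rpow_pos_of_pos hx _
    rw [norm_mul, Complex.norm_real, Real.norm_of_nonneg h4.le]
    gcongr
    rw [← intervalIntegral.integral_const_mul]
    refine intervalIntegral.norm_integral_le_of_norm_le hδπ
      (Eventually.of_forall fun y hy => ?_) (hf2.norm.const_mul _)
    have hy0 : 0 < y := hδ0.trans hy.1
    rw [norm_mul]
    gcongr
    refine (norm_foldedKernel_le σ (inv_pos.2 hx) (inv_le_one_of_one_le₀ hx1)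
      (by rw [abs_of_pos hy0]; exact hy.2)).trans ?_
    have : 0 < x⁻¹ := inv_pos.2 hx
    rw [abs_of_pos hy0]
    gcongr
    linarith [hy.1]
  -- Near `0`, rescale by `y = t / x` and use dominated convergence.
  set H : ℝ → ℝ → ℂ := fun x =>
    (Set.Ioo 0 δ).indicator fun y => foldedKernel σ x⁻¹ y * f y with hH
  have hHi : ∀ x, 0 < x → Integrable (H x) := fun x hx =>
    (integrable_indicator_iff measurableSet_Ioo).2
      ((intervalIntegrable_iff_integrableOn_Ioo_of_le hδ0.le).1
        (hf1.continuousOn_mul (continuous_foldedKernel σ (inv_pos.2 hx)).continuousOn))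
  set F : ℝ → ℝ → ℂ := fun x t => ((x ^ (-2 * d) : ℝ) : ℂ) * ((x : ℂ)⁻¹ * H x (t / x)) with hF
  have hnear : ∀ x, 0 < x → ((x ^ (-2 * d) : ℝ) : ℂ) *
      ∫ y in (0 : ℝ)..δ, foldedKernel σ x⁻¹ y * f y = ∫ t, F x t := by
    intro x hx
    have hx' : (x : ℂ) ≠ 0 := by exact_mod_cast hx.ne'
    rw [hF, integral_const_mul, integral_const_mul, Measure.integral_comp_div, abs_of_pos hx,
      Complex.real_smul, inv_mul_cancel_left₀ hx', hH, integral_indicator measurableSet_Ioo,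
      intervalIntegral.integral_of_le hδ0.le, integral_Ioc_eq_integral_Ioo]
  set G : ℝ → ℝ := (Set.Ioi 0).indicator
    fun t => M * K * (t ^ (-2 * d) * (1 + t)⁻¹) with hG
  have hGi : Integrable G := (integrable_indicator_iff measurableSet_Ioi).2
    ((integrableOn_rpow_div_one_add hd0 hd1).const_mul _)
  have hFG : ∀ x, 1 ≤ x → ∀ t, ‖F x t‖ ≤ G t := by
    intro x hx1 t
    have hx : 0 < x := by linarith
    have hG0 : 0 ≤ G t := Set.indicator_nonneg (fun t (ht : 0 < t) => by positivity) t
    by_cases ht : t / x ∈ Set.Ioo 0 δ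
    · have ht0 : 0 < t := by have := mul_pos ht.1 hx; rwa [div_mul_cancel₀ _ hx.ne'] at this
      have h4 : 0 < x ^ (-2 * d) := Real.rpow_pos_of_pos hx _
      have e1 := hM _ ht.1 ht.2
      have e2 := norm_foldedKernel_le σ (inv_pos.2 hx) (inv_le_one_of_one_le₀ hx1)
        (y := t / x) (by rw [abs_of_pos ht.1]; exact ht.2.le.trans hδπ)
      rw [abs_of_pos ht.1] at e2
      simp only [hF, hH, hG]
      rw [Set.indicator_of_mem ht, Set.indicator_of_mem (by simpa), norm_mul, norm_mul, norm_mul,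
        norm_inv, Complex.norm_real, Complex.norm_real, Real.norm_of_nonneg h4.le,
        Real.norm_of_nonneg hx.le]
      calc _ ≤ x ^ (-2 * d) * (x⁻¹ * (K / (x⁻¹ + t / x) * (M * (t / x) ^ (-2 * d)))) := by gcongr
        _ = _ := by
          rw [Real.div_rpow ht0.le hx.le]
          field_simp
    · simp only [hF, hH]
      rw [Set.indicator_of_notMem ht]
      simpa using hG0
  have hlim : Tendsto (fun x : ℝ => ∫ t, F x t) atTop (𝓝 (∫ t, (Set.Ioi (0 : ℝ)).indicator
      (fun t : ℝ => g * (((t ^ (-2 * d) : ℝ) : ℂ) *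
        ((1 - Complex.I * t)⁻¹ + σ * (1 + Complex.I * t)⁻¹))) t)) := by
    refine tendsto_integral_filter_of_dominated_convergence G ?_ ?_ hGi ?_
    · filter_upwards [eventually_gt_atTop 0] with x hx
      exact ((((hHi x hx).comp_div hx.ne').const_mul _).const_mul _).aestronglyMeasurable
    · filter_upwards [eventually_ge_atTop 1] with x hx using Eventually.of_forall (hFG x hx)
    · refine Eventually.of_forall fun t => ?_
      rcases le_or_gt t 0 with ht | ht
      · rw [Set.indicator_of_notMem (by simpa)]
        refine tendsto_const_nhds.congr' ?_
        filter_upwards [eventually_gt_atTop 0] with x hx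
        simp only [hF, hH]
        rw [Set.indicator_of_notMem]
        · simp
        · exact fun h => (div_nonpos_of_nonpos_of_nonneg ht hx.le).not_gt h.1
      · rw [Set.indicator_of_mem (by simpa)]
        have h1 : Tendsto (fun x : ℝ => t / x) atTop (𝓝[>] 0) := by
          refine tendsto_nhdsWithin_iff.2 ⟨tendsto_const_nhds.div_atTop tendsto_id, ?_⟩
          filter_upwards [eventually_gt_atTop 0] with x hx using div_pos ht hx
        have h2 := (hg.comp h1).mul
          ((tendsto_foldedKernel_div σ t).const_mul ((t ^ (-2 * d) : ℝ) : ℂ))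
        refine h2.congr' ?_
        have h3 : ∀ᶠ x in atTop, t / x < δ :=
          (h1.mono_right nhdsWithin_le_nhds).eventually (gt_mem_nhds hδ0)
        filter_upwards [eventually_gt_atTop 0, h3] with x hx hxδ
        have h4 : x ^ (-2 * d) ≠ 0 := (Real.rpow_pos_of_pos hx _).ne'
        have h5 : t ^ (-2 * d) ≠ 0 := (Real.rpow_pos_of_pos ht _).ne'
        simp only [hF, hH, Function.comp]
        rw [Set.indicator_of_mem (show t / x ∈ Set.Ioo 0 δ from ⟨div_pos ht hx, hxδ⟩),
          Real.div_rpow ht.le hx.le]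
        push_cast
        have h4' : ((x ^ (-2 * d) : ℝ) : ℂ) ≠ 0 := by exact_mod_cast h4
        have h5' : ((t ^ (-2 * d) : ℝ) : ℂ) ≠ 0 := by exact_mod_cast h5
        generalize ((x ^ (-2 * d) : ℝ) : ℂ) = X at h4' ⊢
        generalize ((t ^ (-2 * d) : ℝ) : ℂ) = T at h5' ⊢
        field_simp
  rw [integral_indicator measurableSet_Ioi] at hlim
  have := hlim.add hfar
  rw [add_zero] at this
  refine this.congr' ?_
  filter_upwards [eventually_gt_atTop 0] with x hx
  rw [hsplit x hx, mul_add, hnear x hx]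

/-- Comparison of Abel sums: for coefficients `c n ∼ r n ^ (2 d - 1)` and a density
`f ∼ g y ^ (-2 d)` at `0⁺` of parity `σ`, the two constants are linked by a single integral. -/
theorem mul_Gamma_eq_integral_of_fourier {f : ℝ → ℂ} {c : ℤ → ℝ} {σ r d : ℝ} {g : ℂ}
    (hd0 : 0 < d) (hd1 : d < 1 / 2)
    (hf : IntervalIntegrable f volume (-Real.pi) Real.pi)
    (hc : ∀ h : ℤ, (c h : ℂ) = ∫ x in (-Real.pi)..Real.pi,
      Complex.exp (Complex.I * (h : ℂ) * (x : ℂ)) * f x)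
    (hσ : ∀ h, c (-h) = σ * c h)
    (hr : Tendsto (fun n : ℕ => c n / (n : ℝ) ^ (2 * d - 1)) atTop (𝓝 r))
    (hg : Tendsto (fun y : ℝ => f y / ((y ^ (-2 * d) : ℝ) : ℂ)) (𝓝[>] 0) (𝓝 g)) :
    ((r * Real.Gamma (2 * d) : ℝ) : ℂ) =
      g * ∫ t in Set.Ioi (0 : ℝ), ((t ^ (-2 * d) : ℝ) : ℂ) *
        ((1 - Complex.I * t)⁻¹ + σ * (1 + Complex.I * t)⁻¹) := by
  have hpi := Real.pi_pos
  have hpar := ae_neg_eq_mul_of_fourier (σ := (σ : ℂ)) hf hc fun h => by rw [hσ]; push_cast; rfl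
  have hf1 : IntervalIntegrable f volume (-Real.pi) 0 :=
    hf.mono_set (by
      rw [Set.uIcc_of_le (by linarith), Set.uIcc_of_le (by linarith)]
      exact Set.Icc_subset_Icc_right hpi.le)
  have hf2 : IntervalIntegrable f volume 0 Real.pi :=
    hf.mono_set (by
      rw [Set.uIcc_of_le (by linarith), Set.uIcc_of_le (by linarith)]
      exact Set.Icc_subset_Icc_left (by linarith))
  have hfold : ∀ s : ℝ, 0 < s → ∫ y in (-Real.pi)..Real.pi, abelKernel s y * f y =
      ∫ y in (0 : ℝ)..Real.pi, foldedKernel σ s y * f y := by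
    intro s hs
    have hk := continuous_abelKernel hs
    have hk' : Continuous fun y => (σ : ℂ) * abelKernel s (-y) :=
      continuous_const.mul (hk.comp continuous_neg)
    have e1 : ∫ y in (-Real.pi)..0, abelKernel s y * f y =
        ∫ y in (0 : ℝ)..Real.pi, σ * abelKernel s (-y) * f y := by
      have := intervalIntegral.integral_comp_neg (a := 0) (b := Real.pi)
        (fun y : ℝ => abelKernel s y * f y)
      rw [neg_zero] at this
      rw [← this]
      refine intervalIntegral.integral_congr_ae ?_
      filter_upwards [hpar, Measure.ae_ne volume Real.pi] with y hy hyπ hy'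
      rw [Set.uIoc_of_le hpi.le] at hy'
      rw [hy ⟨by linarith [hy'.1], lt_of_le_of_ne hy'.2 hyπ⟩]
      ring
    rw [← intervalIntegral.integral_add_adjacent_intervals
      (hf1.continuousOn_mul hk.continuousOn) (hf2.continuousOn_mul hk.continuousOn), e1, add_comm,
      ← intervalIntegral.integral_add (hf2.continuousOn_mul hk.continuousOn)
        (hf2.continuousOn_mul hk'.continuousOn)]
    refine intervalIntegral.integral_congr fun y _ => ?_
    simp only [foldedKernel]
    ring
  have h1 := tendsto_abel_sum (by linarith) (by linarith) hr
  rw [show 2 * d - 1 + 1 = 2 * d by ring] at h1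
  have h2 := tendsto_integral_foldedKernel (σ := (σ : ℂ)) hd0 hd1 hf2 hg
  rw [integral_const_mul] at h2
  refine tendsto_nhds_unique (((Complex.continuous_ofReal.tendsto _).comp h1).congr' ?_) h2
  filter_upwards [eventually_gt_atTop 0] with x hx
  have h3 := hasSum_exp_mul_fourier hf hc (inv_pos.2 hx)
  rw [← hfold x⁻¹ (inv_pos.2 hx), ← h3.tsum_eq]
  simp only [Function.comp, Complex.ofReal_mul, Complex.ofReal_tsum, neg_mul, div_eq_mul_inv]

/-- For an even density the rescaled folded kernel tends to `2 / (1 + t ^ 2)`, which produces the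
cosine. -/
theorem eq_of_fourier_even {f : ℝ → ℂ} {c : ℤ → ℝ} {r d g : ℝ} (hd0 : 0 < d) (hd1 : d < 1 / 2)
    (hf : IntervalIntegrable f volume (-Real.pi) Real.pi)
    (hc : ∀ h : ℤ, (c h : ℂ) = ∫ x in (-Real.pi)..Real.pi,
      Complex.exp (Complex.I * (h : ℂ) * (x : ℂ)) * f x)
    (heven : ∀ h, c (-h) = c h)
    (hr : Tendsto (fun n : ℕ => c n / (n : ℝ) ^ (2 * d - 1)) atTop (𝓝 r))
    (hg : Tendsto (fun y : ℝ => f y / ((y ^ (-2 * d) : ℝ) : ℂ)) (𝓝[>] 0) (𝓝 (g : ℂ))) :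
    g = Real.Gamma (2 * d) / Real.pi * Real.cos (Real.pi * d) * r := by
  have hcos : 0 < Real.cos (Real.pi * d) :=
    Real.cos_pos_of_mem_Ioo ⟨by nlinarith [Real.pi_pos], by nlinarith [Real.pi_pos]⟩
  have h := mul_Gamma_eq_integral_of_fourier (σ := 1) hd0 hd1 hf hc (by simpa using heven) hr hg
  have e : ∀ t : ℝ, ((t ^ (-2 * d) : ℝ) : ℂ) *
      ((1 - Complex.I * t)⁻¹ + ((1 : ℝ) : ℂ) * (1 + Complex.I * t)⁻¹) =
      ((2 * (t ^ ((1 - 2 * d) - 1) / (1 + t ^ 2)) : ℝ) : ℂ) := by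
    intro t
    have h1 : (1 - Complex.I * t) ≠ 0 := fun h => by simpa using congrArg Complex.re h
    have h2 : (1 + Complex.I * t) ≠ 0 := fun h => by simpa using congrArg Complex.re h
    have h3 : (1 + (t : ℂ) ^ 2) = (1 - Complex.I * t) * (1 + Complex.I * t) := by
      ring_nf; rw [Complex.I_sq]; ring
    rw [show (1 - 2 * d) - 1 = -2 * d by ring]
    push_cast
    rw [h3]
    field_simp
    ring
  simp_rw [e] at h
  rw [integral_complex_ofReal, integral_const_mul,
    integral_rpow_div_one_add_sq (by linarith) (by linarith), ← Complex.ofReal_mul,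
    Complex.ofReal_inj, show Real.pi * ((1 - 2 * d) / 2) = Real.pi / 2 - Real.pi * d by ring,
    Real.sin_pi_div_two_sub] at h
  have := Real.pi_pos
  rw [mul_comm Real.pi d] at hcos h ⊢
  field_simp at h ⊢
  linarith

/-- For an odd density the rescaled folded kernel tends to `2 i t / (1 + t ^ 2)`, which produces
the sine. -/
theorem eq_of_fourier_odd {f : ℝ → ℂ} {c : ℤ → ℝ} {r d g : ℝ} (hd0 : 0 < d) (hd1 : d < 1 / 2)
    (hf : IntervalIntegrable f volume (-Real.pi) Real.pi)
    (hc : ∀ h : ℤ, (c h : ℂ) = ∫ x in (-Real.pi)..Real.pi,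
      Complex.exp (Complex.I * (h : ℂ) * (x : ℂ)) * f x)
    (hodd : ∀ h, c (-h) = -c h)
    (hr : Tendsto (fun n : ℕ => c n / (n : ℝ) ^ (2 * d - 1)) atTop (𝓝 r))
    (hg : Tendsto (fun y : ℝ => f y / ((y ^ (-2 * d) : ℝ) : ℂ)) (𝓝[>] 0)
      (𝓝 (-(Complex.I * (g : ℂ))))) :
    g = Real.Gamma (2 * d) / Real.pi * Real.sin (Real.pi * d) * r := by
  have hsin : 0 < Real.sin (Real.pi * d) :=
    Real.sin_pos_of_pos_of_lt_pi (by positivity) (by nlinarith [Real.pi_pos])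
  have h := mul_Gamma_eq_integral_of_fourier (σ := -1) hd0 hd1 hf hc (by simpa using hodd) hr hg
  have e : ∀ t : ℝ, 0 < t → ((t ^ (-2 * d) : ℝ) : ℂ) *
      ((1 - Complex.I * t)⁻¹ + ((-1 : ℝ) : ℂ) * (1 + Complex.I * t)⁻¹) =
      Complex.I * ((2 * (t ^ ((2 - 2 * d) - 1) / (1 + t ^ 2)) : ℝ) : ℂ) := by
    intro t ht
    have h1 : (1 - Complex.I * t) ≠ 0 := fun h => by simpa using congrArg Complex.re h
    have h2 : (1 + Complex.I * t) ≠ 0 := fun h => by simpa using congrArg Complex.re h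
    have h3 : (1 + (t : ℂ) ^ 2) = (1 - Complex.I * t) * (1 + Complex.I * t) := by
      ring_nf; rw [Complex.I_sq]; ring
    rw [show (2 - 2 * d) - 1 = -2 * d + 1 by ring, Real.rpow_add_one ht.ne']
    push_cast
    rw [h3]
    field_simp
    ring
  rw [setIntegral_congr_fun measurableSet_Ioi fun t ht => e t ht, integral_const_mul,
    integral_complex_ofReal, integral_const_mul,
    integral_rpow_div_one_add_sq (by linarith) (by linarith),
    show ∀ z : ℂ, -(Complex.I * g) * (Complex.I * z) = g * z by
      intro z; linear_combination (-(g : ℂ) * z) * Complex.I_sq,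
    ← Complex.ofReal_mul,
    Complex.ofReal_inj, show Real.pi * ((2 - 2 * d) / 2) = Real.pi - Real.pi * d by ring,
    Real.sin_pi_sub] at h
  have := Real.pi_pos
  rw [mul_comm Real.pi d] at hsin h ⊢
  field_simp at h ⊢
  linarith

/-! ### Asymptotics of the autocovariance -/

section Covariance
variable {Ω : Type*} [MeasurableSpace Ω] {P : Measure Ω}

theorem IsLinearProcess.acvf_neg {ε Y : ℤ → Ω → Fin 2 → ℝ}
    {A : ℤ → Matrix (Fin 2) (Fin 2) ℝ} (hε : IsWhiteNoise P ε) (hY : IsLinearProcess P ε A Y)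
    (h : ℤ) (i j : Fin 2) : acvf P Y (-h) i j = acvf P Y h j i := by
  have h1 := (Equiv.addRight h).hasSum_iff.2 (hY.hasSum_acvf hε (-h) i j)
  refine h1.unique ((hY.hasSum_acvf hε h j i).congr_fun fun m => ?_)
  simp [Function.comp, Matrix.mul_apply, mul_comm]

/-- The autocovariance of a linear process with power-law coefficients, entry by entry, for
arbitrary limiting matrices `R` at `+∞` and `S` at `-∞`. -/
theorem IsLinearProcess.tendsto_acvf {ε Y : ℤ → Ω → Fin 2 → ℝ}
    {A : ℤ → Matrix (Fin 2) (Fin 2) ℝ} (hε : IsWhiteNoise P ε) (hY : IsLinearProcess P ε A Y)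
    {R S : Matrix (Fin 2) (Fin 2) ℝ} {d : ℝ} (hd0 : 0 < d) (hd1 : d < 1 / 2)
    (hR : MatAsymp (fun l : ℕ => A (l : ℤ)) R (d - 1))
    (hS : MatAsymp (fun l : ℕ => A (-(l : ℤ))) S (d - 1)) (i j : Fin 2) :
    Tendsto (fun h : ℕ => acvf P Y (h : ℤ) i j / (h : ℝ) ^ (2 * d - 1)) atTop
      (𝓝 (∑ k, Real.Gamma d ^ 2 / Real.Gamma (2 * d) *
        ((R i k * R j k + S i k * S j k) * (1 / (2 * Real.cos (Real.pi * d))) +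
          R i k * S j k))) := by
  have hA : ∀ i k, TwoSidedAsymp (fun l => A l i k) (R i k) (S i k) (d - 1) := fun i k =>
    ⟨hR i k, hS i k⟩
  have hcc := fun k => tendsto_crossCorrelation hd0 hd1 (hA i k) (hA j k)
  refine (tendsto_finsetSum Finset.univ fun k _ => (hcc k).2).congr' ?_
  filter_upwards [eventually_gt_atTop 0] with h hh
  rw [← Finset.sum_div]
  congr 1
  refine (hasSum_sum fun k _ => ((hcc k).1 h hh).hasSum).unique
    ((hY.hasSum_acvf hε h i j).congr_fun fun m => ?_)
  simp [Matrix.mul_apply]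

end Covariance
end BivariateLM

theorem proposition3p1 {Ω : Type*} [MeasurableSpace Ω] (P : Measure Ω) [IsProbabilityMeasure P]
    (ε Y : ℤ → Ω → Fin 2 → ℝ) (A : ℤ → Matrix (Fin 2) (Fin 2) ℝ)
    (hε : BivariateLM.IsWhiteNoise P ε)
    (hY : BivariateLM.IsLinearProcess P ε A Y)
    (hA : ∀ l : ℤ, ∃ x y : ℝ, A l = BivariateLM.rotMat x y)
    (d a0 a1 : ℝ) (hd0 : 0 < d) (hd1 : d < 1 / 2)
    (hA_plus : BivariateLM.MatAsymp (fun l : ℕ => A (l : ℤ))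
      (BivariateLM.rotMat a0 a1) (d - 1))
    (hA_minus : BivariateLM.MatAsymp (fun l : ℕ => A (-(l : ℤ)))
      (BivariateLM.rotMat a0 a1).transpose (d - 1)) :
    (∃ r0 r1 : ℝ, BivariateLM.MatAsymp (fun h : ℕ => BivariateLM.acvf P Y (h : ℤ))
      !![r0, -r1; r1, r0] (2 * d - 1)) ∧
    ∀ r0 r1 : ℝ,
      BivariateLM.MatAsymp (fun h : ℕ => BivariateLM.acvf P Y (h : ℤ))
        !![r0, -r1; r1, r0] (2 * d - 1) →
      r0 = Real.Gamma d ^ 2 / Real.Gamma (2 * d) *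
          ((a0 ^ 2 + a1 ^ 2) * (1 / Real.cos (Real.pi * d)) + (a0 ^ 2 - a1 ^ 2)) ∧
      r1 = -2 * a0 * a1 * (Real.Gamma d ^ 2 / Real.Gamma (2 * d)) ∧
      ∀ (f : ℝ → Matrix (Fin 2) (Fin 2) ℂ) (g0 g1 : ℝ),
        BivariateLM.IsSpectralDensity (BivariateLM.acvf P Y) f →
        BivariateLM.MatAsympZero f
          !![(g0 : ℂ), Complex.I * (g1 : ℂ); -(Complex.I * (g1 : ℂ)), (g0 : ℂ)] (-2 * d) →
        g0 = Real.Gamma (2 * d) / Real.pi * Real.cos (Real.pi * d) * r0 ∧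
        g1 = Real.Gamma (2 * d) / Real.pi * Real.sin (Real.pi * d) * r1 := by
  have key : BivariateLM.MatAsymp (fun h : ℕ => BivariateLM.acvf P Y (h : ℤ))
      !![Real.Gamma d ^ 2 / Real.Gamma (2 * d) *
          ((a0 ^ 2 + a1 ^ 2) * (1 / Real.cos (Real.pi * d)) + (a0 ^ 2 - a1 ^ 2)),
        -(-2 * a0 * a1 * (Real.Gamma d ^ 2 / Real.Gamma (2 * d)));
        -2 * a0 * a1 * (Real.Gamma d ^ 2 / Real.Gamma (2 * d)),
        Real.Gamma d ^ 2 / Real.Gamma (2 * d) *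
          ((a0 ^ 2 + a1 ^ 2) * (1 / Real.cos (Real.pi * d)) + (a0 ^ 2 - a1 ^ 2))]
      (2 * d - 1) := by
    intro i j
    convert hY.tendsto_acvf hε hd0 hd1 hA_plus hA_minus i j using 2
    fin_cases i <;> fin_cases j <;>
      simp [BivariateLM.rotMat, Fin.sum_univ_two] <;> ring
  refine ⟨⟨_, _, key⟩, fun r0 r1 hr => ⟨?_, ?_, ?_⟩⟩
  · exact tendsto_nhds_unique (hr 0 0) (key 0 0)
  · exact tendsto_nhds_unique (hr 1 0) (key 1 0)
  · intro f g0 g1 hf hg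
    -- The rotation form of the coefficients makes the off-diagonal autocovariance antisymmetric.
    have hanti : ∀ h : ℤ, BivariateLM.acvf P Y h 0 1 = -BivariateLM.acvf P Y h 1 0 := by
      intro h
      refine (hY.hasSum_acvf hε h 0 1).unique
        ((hY.hasSum_acvf hε h 1 0).neg.congr_fun fun m => ?_)
      obtain ⟨x, y, e1⟩ := hA (m + h)
      obtain ⟨x', y', e2⟩ := hA m
      simp [e1, e2, BivariateLM.rotMat, Matrix.mul_apply, Fin.sum_univ_two]
    exact ⟨BivariateLM.eq_of_fourier_even hd0 hd1 (hf.integrable 0 0) (hf.fourier · 0 0)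
        (fun h => hY.acvf_neg hε h 0 0) (hr 0 0) (hg 0 0),
      BivariateLM.eq_of_fourier_odd hd0 hd1 (hf.integrable 1 0) (hf.fourier · 1 0)
        (fun h => (hY.acvf_neg hε h 1 0).trans (hanti h)) (hr 1 0) (hg 1 0)⟩
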